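/- **Conventions.** All alphabets are finite. A tree domain is a nonempty finite prefix-closed set $D\subseteq\mathbb N^*$ such that $u\cdot i\in D$ and $j<i$ imply $u\cdot j\in D$. An ordered-data tree $t$ over $\Sigma$ is a tree domain $D$ together with a label $\mathrm{lab}_t(u)\in\Sigma$ and a data value $\mathrm{val}_t(u)\in\mathbb N$ for each node $u\in D$. A language over $\Sigma$ is a set of ordered-data trees over $\Sigma$. **Automata.** An unranked tree automaton over $\Sigma$ has a finite state set $Q$, final states $F\subseteq Q$, and a regular language $\delta(q,a)\subseteq Q^*$ for all $q\in Q$, $a\in\Sigma$. An accepting run on $t$ is a map $\rho:D\to Q$ such that $\rho(u\cdot 0)\cdots\rho(u\cdot(n-1))\in\delta(\rho(u),\mathrm{lab}_t(u))$ for every node $u$ with exactly $n$ children, and $\rho(\varepsilon)\in F$. A (letter-to-letter) transducer $\mathcal T$ from $\Sigma$ to $\Gamma$ is such an automaton with a relation $\mu\subseteq Q\times\Sigma\times\Gamma$; an ordered-data tree $t'$ over $\Gamma$ is an output of $\mathcal T$ on $t$ if $t'$ has the same domain and data values as $t$ and there is an accepting run $\rho$ on $t$ with $(\rho(u),\mathrm{lab}_t(u),\mathrm{lab}_{t'}(u))\in\mu$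 for every node $u$. If $d_1<\dots<d_m$ are the data values occurring in an ordered-data tree $t'$ over $\Gamma$, the string representation of $t'$ is the word $\mathcal V_\Gamma(t')=S_1\cdots S_m$ over the alphabet $2^\Gamma$, where $S_i$ is the set of labels of the nodes of $t'$ with data value $d_i$. A weak ordered-data tree automaton (weak ODTA) over $\Sigma$ is a triple $\mathcal S=\langle\mathcal T,\mathcal M,\Gamma_0\rangle$, where $\mathcal T$ is a transducer from $\Sigma$ to some alphabet $\Gamma$, $\mathcal M$ is a finite automaton on strings over $2^\Gamma$, and $\Gamma_0\subseteq\Gamma$. It accepts $t$ if there is an output $t'$ of $\mathcal T$ on $t$ such that $\mathcal M$ accepts $\mathcal V_\Gamma(t')$ and, for every $a\in\Gamma_0$, all the $a$-nodes of $t'$ have pairwise different data values. The language accepted by $\mathcal S$ is the set of all ordered-data trees over $\Sigma$ that it accepts. **Logic.** An ordered-data tree $t$ is a structure on its set of nodes with the label predicates $a(\cdot)$, $a\in\Sigma$, and the binary relations: $E_\downarrow(x,y)$ ($y$ is a child of $x$); $E_\rightarrow(x,y)$ ($y$ is the next sibling of $x$); $x\sim y$ ($x$ and $y$ have the same data value);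 $x\prec y$ (the data value of $x$ is less than that of $y$); $x\prec_{suc}y$ (the data value of $y$ is the least data value in $t$ greater than that of $x$). For a set $\mathcal O$ of these binary relations, $\mathrm{FO}(\mathcal O)$ is first-order logic with equality over $\mathcal O$ and $\mathrm{FO}^2(\mathcal O)$ is its fragment of formulas that use only two variables (which may be requantified). **Theorem.** Let $\Sigma$ be a finite alphabet and $\mathcal L$ a set of ordered-data trees over $\Sigma$. Then $\mathcal L$ is accepted by a weak ODTA over $\Sigma$ if and only if $\mathcal L$ is the set of ordered-data trees over $\Sigma$ that satisfy some sentence of the form $$\exists X_1\cdots\exists X_m\;(\varphi\wedge\psi),$$ where $m \ge 0$, the $X_i$ range over sets of nodes, $\varphi$ is a formula of $\mathrm{FO}^2(E_\downarrow,E_\rightarrow)$ and $\psi$ is a formula of $\mathrm{FO}(\sim,\prec,\prec_{suc})$, both without free first-order variables and both extended with the unary predicates $X_1,\dots,X_m$ and $a(\cdot)$, $a\in\Sigma$. -/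

import Mathlib

namespace ODT

universe u v w

/-! ## Unranked trees and ordered-data trees -/

/-- A (nonempty) unranked finite tree domain: a finite prefix-closed set `D` of words over `ℕ`,
containing the root (the empty word), such that `u · i ∈ D` implies `u · j ∈ D` for `j < i`. -/
structure TreeDomain where
  nodes : Finset (List ℕ)
  root_mem : [] ∈ nodes
  prefix_closed : ∀ u w : List ℕ, w ∈ nodes → u <+: w → u ∈ nodes
  sibling_closed : ∀ (u : List ℕ) (i j : ℕ), u ++ [i] ∈ nodes → j < i → u ++ [j] ∈ nodes

namespace TreeDomain

variable (D : TreeDomain)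

/-- The type of nodes of a tree domain. -/
abbrev Node : Type := {u : List ℕ // u ∈ D.nodes}

/-- The root. -/
def root : D.Node := ⟨[], D.root_mem⟩

/-- The child relation `E↓ (x, y)`: `y` is a child of `x`. -/
def IsChild (x y : D.Node) : Prop := ∃ i : ℕ, y.1 = x.1 ++ [i]

/-- The next-sibling relation `E→ (x, y)`: `x = u · i` and `y = u · (i + 1)`. -/
def IsNextSibling (x y : D.Node) : Prop :=
  ∃ (u : List ℕ) (i : ℕ), x.1 = u ++ [i] ∧ y.1 = u ++ [i + 1]

theorem exists_not_mem (u : List ℕ) : ∃ i : ℕ, u ++ [i] ∉ D.nodes := by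
  by_contra! h
  have hinj : Function.Injective (fun i : ℕ => u ++ [i]) := by
    intro i j hij
    simpa using hij
  exact Set.infinite_of_injective_forall_mem (s := (D.nodes : Set (List ℕ))) hinj
    (fun i => h i) D.nodes.finite_toSet

/-- The number of children of the node `u`, i.e. the least `n` with `u · n ∉ D`. -/
def numChildren (u : D.Node) : ℕ := Nat.find (D.exists_not_mem u.1)

/-- The `i`-th child `u · i` of the node `u`. -/
def child (u : D.Node) (i : Fin (D.numChildren u)) : D.Node :=
  ⟨u.1 ++ [(i : ℕ)], not_not.mp (Nat.find_min (D.exists_not_mem u.1) i.2)⟩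

/-- The children `u · 0, …, u · (n - 1)` of the node `u`, in order. -/
def children (u : D.Node) : List D.Node := List.ofFn (D.child u)

/-- `child` enumerates exactly the children. -/
theorem isChild_iff (x y : D.Node) : D.IsChild x y ↔ y ∈ D.children x := by
  simp only [children, List.mem_ofFn', Set.mem_range, IsChild]
  constructor
  · rintro ⟨i, hi⟩
    have hlt : i < D.numChildren x := by
      by_contra! hle
      have hn : x.1 ++ [D.numChildren x] ∉ D.nodes := Nat.find_spec (D.exists_not_mem x.1)
      rcases hle.lt_or_eq with h | h
      · exact hn (D.sibling_closed x.1 i _ (hi ▸ y.2) h)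
      · exact hn (h ▸ hi ▸ y.2)
    exact ⟨⟨i, hlt⟩, Subtype.ext hi.symm⟩
  · rintro ⟨i, rfl⟩
    exact ⟨i, rfl⟩

end TreeDomain

/-- An `A`-labeled unranked tree. -/
structure LabeledTree (A : Type u) where
  dom : TreeDomain
  lab : dom.Node → A

/-- An ordered-data tree over `A`: every node carries a label in `A` and a data value in `ℕ`. -/
structure DataTree (A : Type u) where
  dom : TreeDomain
  lab : dom.Node → A
  val : dom.Node → ℕ

namespace DataTree

variable {A : Type u} (t : DataTree A)

/-- The projection of an ordered-data tree, forgetting the data values. -/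
def proj : LabeledTree A := ⟨t.dom, t.lab⟩

/-- The ordered-data tree with the same nodes and data values as `t`, labeled by `g`. -/
def relabel {G : Type v} (g : t.dom.Node → G) : DataTree G := ⟨t.dom, g, t.val⟩

/-- `V_t(a)`: the set of data values of the `a`-nodes of `t`. -/
def valuesAt (a : A) : Set ℕ := {d | ∃ u : t.dom.Node, t.lab u = a ∧ t.val u = d}

/-- `V_t`: the finite set of data values of `t`. -/
def values : Finset ℕ := Finset.univ.image t.val

/-- `[S]_t`: the data values found in `a`-nodes for all `a ∈ S` and in no `b`-node for `b ∉ S`. -/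
def exactly (S : Set A) : Set ℕ := (⋂ a ∈ S, t.valuesAt a) ∩ ⋂ b ∈ Sᶜ, (t.valuesAt b)ᶜ

/-- The set of labels of the nodes with data value `d`. -/
def labelsAt (d : ℕ) : Set A := {a | d ∈ t.valuesAt a}

/-- `labelsAt d` is the unique set `S` such that `d ∈ [S]_t`. -/
theorem mem_exactly_iff (d : ℕ) (S : Set A) : d ∈ t.exactly S ↔ S = t.labelsAt d := by
  simp only [exactly, labelsAt, Set.mem_inter_iff, Set.mem_iInter, Set.mem_compl_iff, Set.ext_iff,
    Set.mem_ofPred_eq]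
  constructor
  · rintro ⟨h1, h2⟩ a
    exact ⟨h1 a, fun h => by_contra fun hn => h2 a hn h⟩
  · intro h
    exact ⟨fun a ha => (h a).1 ha, fun a ha hd => ha ((h a).2 hd)⟩

/-- The string representation `S₁ ⋯ Sₘ` of the data values `d₁ < ⋯ < dₘ` of `t`:
the word over the alphabet of sets of labels with `dᵢ ∈ [Sᵢ]_t`. -/
def stringRep : List (Set A) := (t.values.sort (· ≤ ·)).map t.labelsAt

end DataTree

/-! ## Tree automata, transducers and weak ordered-data tree automata -/

/-- A (nondeterministic) unranked tree automaton over `A`-labeled trees. -/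
structure TreeAutomaton (A : Type u) where
  State : Type
  finite_state : Finite State
  trans : State → A → Language State
  regular_trans : ∀ q a, (trans q a).IsRegular
  final : Set State

/-- `r` is an accepting run of the tree automaton on the tree `t`. -/
def TreeAutomaton.IsAcceptingRun {A : Type u} (M : TreeAutomaton A) (t : LabeledTree A)
    (r : t.dom.Node → M.State) : Prop :=
  (∀ u : t.dom.Node, (t.dom.children u).map r ∈ M.trans (r u) (t.lab u)) ∧
    r t.dom.root ∈ M.final

/-- An unranked letter-to-letter tree transducer from `A` to `G`. -/
structure TreeTransducer (A : Type u) (G : Type v) where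
  automaton : TreeAutomaton A
  output : Set (automaton.State × A × G)

/-- The tree with the nodes of `t` and the labels `g` is an output of the transducer on `t`. -/
def TreeTransducer.IsOutput {A : Type u} {G : Type v} (T : TreeTransducer A G)
    (t : LabeledTree A) (g : t.dom.Node → G) : Prop :=
  ∃ r : t.dom.Node → T.automaton.State, T.automaton.IsAcceptingRun t r ∧
    ∀ u : t.dom.Node, (r u, t.lab u, g u) ∈ T.output

/-- A weak ordered-data tree automaton over `A`, with output alphabet `Out`: a transducer from `A`
to `Out`, a finite string automaton over the alphabet of subsets of `Out`, and a subset of `Out`. -/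
structure WeakODTA (A : Type u) where
  Out : Type
  finite_out : Finite Out
  transducer : TreeTransducer A Out
  State : Type
  finite_state : Finite State
  automaton : NFA (Set Out) State
  keys : Set Out

/-- Acceptance: for some output `t'` (with the data values of `t`) of the transducer on `t`, the
string automaton accepts the string representation of `t'`, and for every `a ∈ keys` all the
`a`-nodes of `t'` have different data values. -/
def WeakODTA.Accepts {A : Type u} (S : WeakODTA A) (t : DataTree A) : Prop :=
  ∃ g : t.dom.Node → S.Out, S.transducer.IsOutput t.proj g ∧
    (t.relabel g).stringRep ∈ S.automaton.accepts ∧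
    ∀ a ∈ S.keys, ∀ x y : t.dom.Node, g x = a → g y = a → x ≠ y → t.val x ≠ t.val y

/-- The language of ordered-data trees accepted by a weak ordered-data tree automaton. -/
def WeakODTA.language {A : Type u} (S : WeakODTA A) : Set (DataTree A) := {t | S.Accepts t}

/-! ## First-order logic on ordered-data trees -/

/-- The binary relation symbols `E↓`, `E→`, `∼`, `≺`, `≺_suc`. -/
inductive BinRel where
  | child | nextSibling | dataEq | dataLt | dataSuc

/-- Interpretation of the binary relation symbols in an ordered-data tree. -/
def BinRel.Holds {A : Type u} (t : DataTree A) : BinRel → t.dom.Node → t.dom.Node → Prop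
  | child, x, y => t.dom.IsChild x y
  | nextSibling, x, y => t.dom.IsNextSibling x y
  | dataEq, x, y => t.val x = t.val y
  | dataLt, x, y => t.val x < t.val y
  | dataSuc, x, y => t.val x < t.val y ∧ ∀ z : t.dom.Node, t.val x < t.val z → t.val y ≤ t.val z

/-- First-order formulas (with equality) with variables from `V`, unary predicate symbols from `P`
and binary relation symbols from `O`. Variables may be requantified. -/
inductive FO (V : Type u) (P : Type v) (O : Set BinRel) : Type (max u v) where
  | eq (x y : V) : FO V P O
  | pred (p : P) (x : V) : FO V P O
  | rel (R : BinRel) (hR : R ∈ O) (x y : V) : FO V P O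
  | neg (φ : FO V P O) : FO V P O
  | conj (φ ψ : FO V P O) : FO V P O
  | disj (φ ψ : FO V P O) : FO V P O
  | all (x : V) (φ : FO V P O) : FO V P O
  | ex (x : V) (φ : FO V P O) : FO V P O

namespace FO

variable {V : Type u} {P : Type v} {O : Set BinRel}

/-- The free variables of a formula. -/
def freeVars : FO V P O → Set V
  | eq x y => {x, y}
  | pred _ x => {x}
  | rel _ _ x y => {x, y}
  | neg φ => φ.freeVars
  | conj φ ψ => φ.freeVars ∪ ψ.freeVars
  | disj φ ψ => φ.freeVars ∪ ψ.freeVars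
  | all x φ => φ.freeVars \ {x}
  | ex x φ => φ.freeVars \ {x}

/-- A sentence is a formula without free variables. -/
def IsSentence (φ : FO V P O) : Prop := φ.freeVars = ∅

/-- Satisfaction in an ordered-data tree, where the unary predicate symbols are interpreted by `I`
and the variables by the assignment `s`. -/
def Sat [DecidableEq V] {A : Type w} (t : DataTree A) (I : P → Set t.dom.Node) :
    FO V P O → (V → t.dom.Node) → Prop
  | eq x y, s => s x = s y
  | pred p x, s => s x ∈ I p
  | rel R _ x y, s => R.Holds t (s x) (s y)
  | neg φ, s => ¬ φ.Sat t I s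
  | conj φ ψ, s => φ.Sat t I s ∧ ψ.Sat t I s
  | disj φ ψ, s => φ.Sat t I s ∨ ψ.Sat t I s
  | all x φ, s => ∀ n : t.dom.Node, φ.Sat t I (Function.update s x n)
  | ex x φ, s => ∃ n : t.dom.Node, φ.Sat t I (Function.update s x n)

/-- Truth of a formula (meant for sentences) in an ordered-data tree, whose nodes form a nonempty
set: it is satisfied under every assignment. -/
def Models [DecidableEq V] {A : Type w} (t : DataTree A) (I : P → Set t.dom.Node)
    (φ : FO V P O) : Prop :=
  ∀ s : V → t.dom.Node, φ.Sat t I s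

end FO

/-- The interpretation of the unary predicate symbols `a(·)`, `a ∈ A`, by the labels of `t`, and of
the set variables `X₁, …, Xₘ` by given sets of nodes. -/
def unaryInterp {A : Type u} (t : DataTree A) {m : ℕ} (X : Fin m → Set t.dom.Node) :
    A ⊕ Fin m → Set t.dom.Node
  | Sum.inl a => {x | t.lab x = a}
  | Sum.inr i => X i

/-- `FO²(O)`: formulas with only two variables, over the unary predicates `a(·)` and
`X₁, …, Xₘ`. -/
abbrev FO2 (A : Type u) (m : ℕ) (O : Set BinRel) : Type u := FO (Fin 2) (A ⊕ Fin m) O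

/-- `FO(O)`: formulas with arbitrarily many variables, over the unary predicates `a(·)` and
`X₁, …, Xₘ`. -/
abbrev FOω (A : Type u) (m : ℕ) (O : Set BinRel) : Type u := FO ℕ (A ⊕ Fin m) O

/-- The language of ordered-data trees defined by `∃ X₁ ⋯ ∃ Xₘ (φ ∧ ψ)`. -/
def definedLanguage {A : Type u} {m : ℕ} {O₁ O₂ : Set BinRel} (φ : FO2 A m O₁)
    (ψ : FOω A m O₂) : Set (DataTree A) :=
  {t | ∃ X : Fin m → Set t.dom.Node,
    φ.Models t (unaryInterp t X) ∧ ψ.Models t (unaryInterp t X)}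

end ODT

namespace ODT

universe u v w

/-! ## Regular languages -/

/-! Formula to automaton. The sets `X i` become part of the label of a node, which the transducer
guesses, so that φ and ψ can be treated separately over the enlarged finite label set.

With two variables, quantifying one of them leaves a single fixed node, and a formula over child and
next sibling only asks where the new node lies relative to it: equal, child, parent, adjacent
sibling, or far. Hence φ depends only on the `k`-fold iterate of the map that sends a labelling to
"own label, together with the set of (label, relative position) of all nodes"
(`FO.exists_determinedAt`). One iteration is computed by a transducer: it guesses what lies inside
and what lies outside each subtree, and these guesses are forced by local equations
(`nbhdTransducer_isOutput`).

A formula ψ over the data order sees a tree as a linear preorder with labels, so an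
Ehrenfeucht–Fraïssé argument applies: for each pair of data value and label only the number of nodes
up to a threshold `N` matters (`hintikkaType_eq_of_colors`). Weak ODTAs can count up to a threshold.
Each output label carries a number in `0, …, N`; labels with number below `N` are keys, and the
string automaton checks that number `N` occurs only together with all smaller ones. The string
representation then has the same type as the tree (`hintikkaType_ofTree`). Types are finite in
number and compose under ordered sums (`hintikkaType_sum`), so the words whose type satisfies ψ form
a regular language.

Automaton to formula. An accepting computation is a labelling of the nodes by finitely many letters:
state, output label, states of the automata reading the rows of children, set of output labels at
the data value, and state of the string automaton there. Its correctness is a conjunction of local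
conditions, along the tree in two variables (`TreeTransducer.isOutput_iff_tiling`) and along the
data values (`valueSystem_holds_iff`). Set variables encode the labelling
(`exists_formula_of_systems`). -/

theorem isRegular_of_finite_invariant {α : Type u} {τ : Type v} [Finite τ] {L : Language α}
    (θ : List α → τ) (h : ∀ x x', θ x = θ x' → ∀ y, x ++ y ∈ L → x' ++ y ∈ L) :
    L.IsRegular := by
  refine Language.IsRegular.of_finite_range_leftQuotient ?_
  have : ∀ x x', θ x = θ x' → L.leftQuotient x = L.leftQuotient x' := fun x x' e =>
    Set.ext fun y => ⟨h x x' e y, h x' x e.symm y⟩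
  -- By Myhill–Nerode, finitely many left quotients suffice: one representative word for each value
  -- of `θ` yields them all.
  refine (Set.finite_range (fun t : Set.range θ => L.leftQuotient t.2.choose)).subset ?_
  rintro _ ⟨x, rfl⟩
  exact ⟨⟨θ x, x, rfl⟩, this _ _ (Set.mem_range_self (f := θ) x).choose_spec⟩

theorem isRegular_comap_map {α : Type u} {β : Type v} {L : Language β} (hL : L.IsRegular)
    (f : α → β) : Language.IsRegular ({w | w.map f ∈ L} : Set (List α)) := by
  obtain ⟨σ, hσ, M, rfl⟩ := hL
  exact ⟨σ, hσ, M.comap f, by rw [DFA.accepts_comap]; rfl⟩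

/-- The part of a word before a letter: its last letter and the set of its other letters. -/
def leftContext {Y : Type u} (a : List Y) : Option Y × Set Y := (a.getLast?, {y | y ∈ a.dropLast})

/-- The part of a word after a letter: its first letter and the set of its other letters. -/
def rightContext {Y : Type u} (b : List Y) : Option Y × Set Y := (b.head?, {y | y ∈ b.tail})

/-- A nonempty `c` turns the last letter of `x` into an inner letter, so the inner letters of `x ++
c` include all letters of `x`; this is what `hs` controls. -/
theorem leftContext_append {Y : Type u} {x x' : List Y} (h : leftContext x = leftContext x')
    (hs : {y | y ∈ x} = {y | y ∈ x'}) (c : List Y) :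
    leftContext (x ++ c) = leftContext (x' ++ c) := by
  rcases eq_or_ne c [] with rfl | hc
  · simpa using h
  · have hs' : ∀ y, y ∈ x ↔ y ∈ x' := fun y => Set.ext_iff.1 hs y
    simp [leftContext, List.dropLast_append_of_ne_nil hc, List.getLast?_append_of_ne_nil _ hc, hs']

/-- Appended letters join the tail unless the word is empty, and the first letter already reveals
emptiness. So no counterpart of the hypothesis on all letters is needed here. -/
theorem rightContext_append {Y : Type u} {x x' : List Y} (h : rightContext x = rightContext x')
    (c : List Y) : rightContext (x ++ c) = rightContext (x' ++ c) := by
  have h1 : x.head? = x'.head? := congrArg Prod.fst h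
  have h2 : ∀ y, y ∈ x.tail ↔ y ∈ x'.tail := fun y => Set.ext_iff.1 (congrArg Prod.snd h) y
  cases x with
  | nil => cases x' with
    | nil => rfl
    | cons => simp at h1
  | cons p x => cases x' with
    | nil => simp at h1
    | cons q x' =>
      simp only [List.tail_cons] at h2
      simp at h1
      simp [rightContext, h1, h2]

/-- A condition on each letter of a word and on its two contexts is regular: a finite invariant of a
prefix is its letter set, its left context, and the set of triples (left context, letter, right
context) that occur in it. -/
theorem isRegular_contexts {Q : Type u} [Finite Q] {Y : Type v} [Finite Y] (f : Q → Y)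
    (P₀ : Set Y → Prop) (P : Option Y × Set Y → Q → Option Y × Set Y → Prop) :
    Language.IsRegular ({w | P₀ {y | y ∈ w.map f} ∧ ∀ a q b, w = a ++ q :: b →
      P (leftContext (a.map f)) q (rightContext (b.map f))} : Set (List Q)) := by
  refine isRegular_of_finite_invariant
    (τ := Set Y × (Option Y × Set Y) × Set ((Option Y × Set Y) × Q × (Option Y × Set Y)))
    (fun x => ({y | y ∈ x.map f}, leftContext (x.map f),
      {p | ∃ a q b, x = a ++ q :: b ∧ p = (leftContext (a.map f), q, rightContext (b.map f))})) ?_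
  intro x x' h y hy
  simp only [Prod.mk.injEq] at h
  obtain ⟨h1, h2, h3⟩ := h
  obtain ⟨hy0, hy⟩ := hy
  refine ⟨?_, ?_⟩
  · convert hy0 using 1
    have : ∀ z, z ∈ x.map f ↔ z ∈ x'.map f := fun z => Set.ext_iff.1 h1 z
    ext z
    rw [Set.mem_ofPred_eq, Set.mem_ofPred_eq, List.map_append, List.map_append, List.mem_append,
      List.mem_append, this]
  · intro a q b e
    -- The distinguished letter lies in `y` or in `x'`. In the latter case its triple also occurs in
    -- `x`, and the condition is transferred from there.
    rw [List.append_eq_append_iff] at e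
    rcases e with ⟨c, rfl, rfl⟩ | ⟨c, hc, hc'⟩
    · have := hy (x ++ c) q b (by simp)
      rw [List.map_append, leftContext_append h2 h1] at this
      rwa [List.map_append]
    · cases c with
      | nil =>
        simp only [List.append_nil, List.nil_append] at hc hc'
        have := hy x q b (by simp [hc'])
        rw [h2] at this
        rwa [← hc]
      | cons q' c =>
        obtain ⟨rfl, rfl⟩ : q = q' ∧ b = c ++ y := by simpa using hc'
        have : (leftContext (a.map f), q, rightContext (c.map f)) ∈
          {p | ∃ a q b, x = a ++ q :: b ∧
            p = (leftContext (a.map f), q, rightContext (b.map f))} := by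
          rw [h3]; exact ⟨a, q, c, hc, rfl⟩
        obtain ⟨a', q', c', rfl, e'⟩ := this
        simp only [Prod.mk.injEq] at e'
        obtain ⟨e1, rfl, e2⟩ := e'
        have := hy a' q (c' ++ y) (by simp)
        rw [List.map_append, ← rightContext_append e2, ← e1] at this
        rwa [List.map_append]

/-! ## Composition of transducers and the neighbourhood transducer -/

/-- The composition of two letter-to-letter tree transducers. -/
def TreeTransducer.comp {A : Type u} {B : Type} {C : Type w} [Finite B] (T₁ : TreeTransducer A B)
    (T₂ : TreeTransducer B C) : TreeTransducer A C where
  automaton :=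
    -- The last component guesses the intermediate label, which the second automaton reads as its
    -- input.
    { State := T₁.automaton.State × T₂.automaton.State × B
      finite_state := by
        have := T₁.automaton.finite_state
        have := T₂.automaton.finite_state
        infer_instance
      trans := fun q a => ({w | w.map Prod.fst ∈ T₁.automaton.trans q.1 a} : Set (List _)) ⊓
        ({w | w.map (fun q => q.2.1) ∈ T₂.automaton.trans q.2.1 q.2.2} : Set (List _))
      regular_trans := fun q a =>
        (isRegular_comap_map (T₁.automaton.regular_trans _ _) _).inf
          (isRegular_comap_map (T₂.automaton.regular_trans _ _) _)
      final := {q | q.1 ∈ T₁.automaton.final ∧ q.2.1 ∈ T₂.automaton.final} }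
  output := {p | (p.1.1, p.2.1, p.1.2.2) ∈ T₁.output ∧ (p.1.2.1, p.1.2.2, p.2.2) ∈ T₂.output}

theorem TreeTransducer.comp_isOutput {A : Type u} {B : Type} {C : Type w} [Finite B]
    (T₁ : TreeTransducer A B) (T₂ : TreeTransducer B C) (D : TreeDomain) (x : D.Node → A)
    (z : D.Node → C) : (T₁.comp T₂).IsOutput ⟨D, x⟩ z ↔
      ∃ y : D.Node → B, T₁.IsOutput ⟨D, x⟩ y ∧ T₂.IsOutput ⟨D, y⟩ z := by
  constructor
  · rintro ⟨(r : D.Node → T₁.automaton.State × T₂.automaton.State × B), ⟨hr, hf⟩, ho⟩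
    refine ⟨fun u => (r u).2.2, ⟨fun u => (r u).1, ⟨fun u => ?_, hf.1⟩, fun u => (ho u).1⟩,
      ⟨fun u => (r u).2.1, ⟨fun u => ?_, hf.2⟩, fun u => (ho u).2⟩⟩
    · have : ((D.children u).map r).map Prod.fst ∈ T₁.automaton.trans (r u).1 (x u) := (hr u).1
      rwa [List.map_map] at this
    · have : ((D.children u).map r).map (fun q => q.2.1) ∈
        T₂.automaton.trans (r u).2.1 (r u).2.2 := (hr u).2
      rwa [List.map_map] at this
  · rintro ⟨y, ⟨r₁, ⟨h1, f1⟩, o1⟩, ⟨r₂, ⟨h2, f2⟩, o2⟩⟩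
    refine ⟨fun u => (r₁ u, r₂ u, y u), ⟨fun u => ⟨?_, ?_⟩, f1, f2⟩, fun u => ⟨o1 u, o2 u⟩⟩
    · change ((D.children u).map _).map _ ∈ T₁.automaton.trans (r₁ u) (x u)
      rw [List.map_map]
      exact h1 u
    · change ((D.children u).map _).map _ ∈ T₂.automaton.trans (r₂ u) (y u)
      rw [List.map_map]
      exact h2 u

/-- The transducer that relabels the nodes according to a relation. -/
def TreeTransducer.relabel {A : Type u} {B : Type v} (R : A → B → Prop) : TreeTransducer A B where
  automaton :=
    { State := Unit
      finite_state := inferInstance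
      trans := fun _ _ => ⊤
      regular_trans := fun _ _ => ⟨Unit, inferInstance, ⟨fun _ _ => (), (), Set.univ⟩, by
        exact Set.ext fun _ => ⟨fun _ => trivial, fun _ => trivial⟩⟩
      final := Set.univ }
  output := {p | R p.2.1 p.2.2}

theorem TreeTransducer.relabel_isOutput {A : Type u} {B : Type v} (R : A → B → Prop)
    (D : TreeDomain) (x : D.Node → A) (y : D.Node → B) :
    (TreeTransducer.relabel R).IsOutput ⟨D, x⟩ y ↔ ∀ u, R (x u) (y u) :=
  ⟨fun ⟨_, _, h⟩ u => h u, fun h => ⟨fun _ => (), ⟨fun _ => trivial, trivial⟩, h⟩⟩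

/-- The transducer that checks a property of the label of the root and changes no label. -/
def TreeTransducer.rootCheck {B : Type} [Finite B] (P : B → Prop) : TreeTransducer B B where
  automaton :=
    { State := B
      finite_state := inferInstance
      trans := fun _ _ => ⊤
      regular_trans := fun _ _ => ⟨Unit, inferInstance, ⟨fun _ _ => (), (), Set.univ⟩, by
        exact Set.ext fun _ => ⟨fun _ => trivial, fun _ => trivial⟩⟩
      final := {b | P b} }
  output := {p | p.1 = p.2.1 ∧ p.1 = p.2.2}

theorem TreeTransducer.rootCheck_isOutput {B : Type} [Finite B] (P : B → Prop)
    (D : TreeDomain) (x y : D.Node → B) :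
    (TreeTransducer.rootCheck P).IsOutput ⟨D, x⟩ y ↔ y = x ∧ P (x D.root) := by
  constructor
  · rintro ⟨r, ⟨_, hf⟩, h⟩
    have h1 : r = x := funext fun u => (h u).1
    have h2 : r = y := funext fun u => (h u).2
    exact ⟨h2 ▸ h1, h1 ▸ hf⟩
  · rintro ⟨rfl, h⟩
    exact ⟨y, ⟨fun _ => trivial, h⟩, fun u => ⟨rfl, rfl⟩⟩

/-- The possible positions of a node relative to another one. -/
inductive NodeRel where
  | eq | child | parent | next | prev | far
  deriving DecidableEq

instance : Finite NodeRel :=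
  Finite.of_surjective (fun i : Fin 6 => match i with
    | 0 => NodeRel.eq | 1 => .child | 2 => .parent | 3 => .next | 4 => .prev | 5 => .far) (by
      rintro (_ | _ | _ | _ | _ | _)
      exacts [⟨0, rfl⟩, ⟨1, rfl⟩, ⟨2, rfl⟩, ⟨3, rfl⟩, ⟨4, rfl⟩, ⟨5, rfl⟩])

open scoped Classical in
/-- `nodeRel u v` is the position of `v` relative to `u`. -/
noncomputable def nodeRel (u v : List ℕ) : NodeRel :=
  if v = u then .eq
  else if ∃ i, v = u ++ [i] then .child
  else if ∃ i, u = v ++ [i] then .parent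
  else if ∃ p i, u = p ++ [i] ∧ v = p ++ [i + 1] then .next
  else if ∃ p i, v = p ++ [i] ∧ u = p ++ [i + 1] then .prev
  else .far

theorem append_singleton_inj {p q : List ℕ} {i j : ℕ} : p ++ [i] = q ++ [j] ↔ p = q ∧ i = j := by
  constructor
  · intro h
    have := List.append_inj' h rfl
    simpa using this
  · rintro ⟨rfl, rfl⟩; rfl

theorem nodeRel_self (u : List ℕ) : nodeRel u u = .eq := by simp [nodeRel]

theorem nodeRel_child (u : List ℕ) (i : ℕ) : nodeRel u (u ++ [i]) = .child := by simp [nodeRel]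

theorem nodeRel_parent (u : List ℕ) (i : ℕ) : nodeRel (u ++ [i]) u = .parent := by
  simp [nodeRel]

theorem nodeRel_sibling (p : List ℕ) {i j : ℕ} (h : j ≠ i) : nodeRel (p ++ [i]) (p ++ [j]) =
    if j = i + 1 then .next else if i = j + 1 then .prev else .far := by
  have hl : ∀ k l m : ℕ, ¬ p ++ [k] = p ++ [l] ++ [m] := fun k l m e => by
    have := congrArg List.length e
    simp at this
  unfold nodeRel
  rw [if_neg (by simpa using h), if_neg (by rintro ⟨k, hk⟩; exact hl _ _ _ hk),
    if_neg (by rintro ⟨k, hk⟩; exact hl _ _ _ hk)]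
  have h1 : (∃ q k, p ++ [i] = q ++ [k] ∧ p ++ [j] = q ++ [k + 1]) ↔ j = i + 1 := by
    simp only [append_singleton_inj]
    exact ⟨by rintro ⟨q, k, ⟨-, rfl⟩, -, rfl⟩; rfl, fun e => ⟨p, i, ⟨rfl, rfl⟩, rfl, e⟩⟩
  have h2 : (∃ q k, p ++ [j] = q ++ [k] ∧ p ++ [i] = q ++ [k + 1]) ↔ i = j + 1 := by
    simp only [append_singleton_inj]
    exact ⟨by rintro ⟨q, k, ⟨-, rfl⟩, -, rfl⟩; rfl, fun e => ⟨p, j, ⟨rfl, rfl⟩, rfl, e⟩⟩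
  simp only [h1, h2]

theorem nodeRel_far_of_length {u v : List ℕ} (h : u.length + 2 ≤ v.length) :
    nodeRel u v = .far := by
  unfold nodeRel
  rw [if_neg, if_neg, if_neg, if_neg, if_neg]
  all_goals (intro e; grind)

theorem nodeRel_far_of_not_prefix {p v : List ℕ} (i : ℕ) (h : ¬ p <+: v) :
    nodeRel (p ++ [i]) v = .far := by
  unfold nodeRel
  rw [if_neg, if_neg, if_neg, if_neg, if_neg]
  · rintro ⟨q, j, rfl, e⟩
    obtain ⟨rfl, -⟩ := append_singleton_inj.1 e
    exact h (List.prefix_append _ _)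
  · rintro ⟨q, j, e, rfl⟩
    obtain ⟨rfl, -⟩ := append_singleton_inj.1 e
    exact h (List.prefix_append _ _)
  · rintro ⟨j, e⟩
    obtain ⟨rfl, -⟩ := append_singleton_inj.1 e
    exact h (List.prefix_refl _)
  · rintro ⟨j, rfl⟩
    exact h (by simp)
  · rintro rfl
    exact h (List.prefix_append _ _)

theorem nodeRel_far_of_nephew (p w : List ℕ) {i j : ℕ} (h : j ≠ i) (hw : w ≠ []) :
    nodeRel (p ++ [i]) (p ++ [j] ++ w) = .far := by
  have hlen : 0 < w.length := List.length_pos_iff.2 hw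
  unfold nodeRel
  rw [if_neg, if_neg, if_neg, if_neg, if_neg]
  · rintro ⟨q, k, e, e'⟩
    have := congrArg List.length e
    have := congrArg List.length e'
    simp at *; omega
  · rintro ⟨q, k, e, e'⟩
    have := congrArg List.length e
    have := congrArg List.length e'
    simp at *; omega
  · rintro ⟨k, e⟩
    have := congrArg List.length e
    simp at *
  · rintro ⟨k, e⟩
    simp only [List.append_assoc, List.append_cancel_left_eq] at e
    simp at e
    exact h e.1
  · intro e
    have := congrArg List.length e
    simp at *; omega

theorem nodeRel_eq_iff (u v : List ℕ) : nodeRel u v = .eq ↔ u = v := by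
  unfold nodeRel
  split_ifs <;> grind

theorem nodeRel_eq_child_iff (u v : List ℕ) : nodeRel u v = .child ↔ ∃ i, v = u ++ [i] := by
  refine ⟨fun h => ?_, fun ⟨i, e⟩ => e ▸ nodeRel_child u i⟩
  unfold nodeRel at h
  split_ifs at h
  assumption

theorem nodeRel_eq_next_iff (u v : List ℕ) :
    nodeRel u v = .next ↔ ∃ p i, u = p ++ [i] ∧ v = p ++ [i + 1] := by
  refine ⟨fun h => ?_, ?_⟩
  · unfold nodeRel at h
    split_ifs at h
    assumption
  · rintro ⟨p, i, rfl, rfl⟩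
    rw [nodeRel_sibling p (by simp), if_pos rfl]

/-- The inverse position. -/
def NodeRel.symm : NodeRel → NodeRel
  | .eq => .eq | .child => .parent | .parent => .child | .next => .prev | .prev => .next
  | .far => .far

theorem nodeRel_symm (u v : List ℕ) : nodeRel v u = (nodeRel u v).symm := by
  by_cases h1 : v = u
  · subst h1; simp [nodeRel_self, NodeRel.symm]
  by_cases h2 : ∃ i, v = u ++ [i]
  · obtain ⟨i, rfl⟩ := h2
    rw [nodeRel_child, nodeRel_parent]; rfl
  by_cases h3 : ∃ i, u = v ++ [i]
  · obtain ⟨i, rfl⟩ := h3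
    rw [nodeRel_child, nodeRel_parent]; rfl
  by_cases h4 : ∃ p i, u = p ++ [i] ∧ v = p ++ [i + 1]
  · obtain ⟨p, i, rfl, rfl⟩ := h4
    rw [nodeRel_sibling p (by simp), nodeRel_sibling p (by simp)]
    rw [if_pos rfl, if_neg (by omega), if_pos rfl]; rfl
  by_cases h5 : ∃ p i, v = p ++ [i] ∧ u = p ++ [i + 1]
  · obtain ⟨p, i, rfl, rfl⟩ := h5
    rw [nodeRel_sibling p (by simp), nodeRel_sibling p (by simp)]
    rw [if_pos rfl, if_neg (by omega), if_pos rfl]; rfl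
  · have h1' : ¬ u = v := fun e => h1 e.symm
    unfold nodeRel
    rw [if_neg h1', if_neg h3, if_neg h2, if_neg h5, if_neg h4, if_neg h1, if_neg h2, if_neg h3,
      if_neg h4, if_neg h5]
    rfl

/-! ### Positions in a list of children split at one child -/

namespace TreeDomain
variable (D : TreeDomain)

theorem lt_numChildren_iff (p : D.Node) (i : ℕ) : i < D.numChildren p ↔ p.1 ++ [i] ∈ D.nodes := by
  constructor
  · exact fun h => not_not.mp (Nat.find_min (D.exists_not_mem p.1) h)
  · intro h
    by_contra! hle
    have hn : p.1 ++ [D.numChildren p] ∉ D.nodes := Nat.find_spec (D.exists_not_mem p.1)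
    rcases hle.lt_or_eq with h' | h'
    · exact hn (D.sibling_closed p.1 i _ h h')
    · exact hn (h' ▸ h)

theorem children_getElem? (p v : D.Node) (j : ℕ) :
    (D.children p)[j]? = some v ↔ v.1 = p.1 ++ [j] := by
  rw [children, List.getElem?_ofFn]
  by_cases h : j < D.numChildren p
  · rw [dif_pos h, Option.some_inj]
    exact ⟨fun e => e ▸ rfl, fun e => Subtype.ext e.symm⟩
  · rw [dif_neg h]
    refine ⟨fun e => by simp at e, fun e => absurd ?_ h⟩
    rw [lt_numChildren_iff, ← e]
    exact v.2

variable {D} {p c : D.Node} {a b : List D.Node} (h : D.children p = a ++ c :: b)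
include h

theorem children_split_mid : c.1 = p.1 ++ [a.length] := by
  rw [← children_getElem?, h]; simp

theorem children_split_left_getElem? (v : D.Node) (j : ℕ) :
    a[j]? = some v ↔ j < a.length ∧ v.1 = p.1 ++ [j] := by
  rw [← children_getElem?, h]
  by_cases hj : j < a.length
  · simp [hj, List.getElem?_append_left]
  · simp [hj]

theorem children_split_right_getElem? (v : D.Node) (j : ℕ) :
    b[j]? = some v ↔ v.1 = p.1 ++ [a.length + 1 + j] := by
  rw [← children_getElem?, h, List.getElem?_append_right (by omega)]
  rw [show a.length + 1 + j - a.length = j + 1 by omega, List.getElem?_cons_succ]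

theorem children_split_getLast? (v : D.Node) :
    a.getLast? = some v ↔ ∃ j, a.length = j + 1 ∧ v.1 = p.1 ++ [j] := by
  rw [List.getLast?_eq_getElem?, children_split_left_getElem? h]
  constructor
  · exact fun ⟨h1, h2⟩ => ⟨a.length - 1, by omega, h2⟩
  · rintro ⟨j, h1, h2⟩
    exact ⟨by omega, by rw [h2, h1]; rfl⟩

theorem children_split_mem_dropLast (v : D.Node) :
    v ∈ a.dropLast ↔ ∃ j, j + 1 < a.length ∧ v.1 = p.1 ++ [j] := by
  rw [List.mem_iff_getElem?]
  refine exists_congr fun j => ?_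
  rw [List.getElem?_dropLast]
  split_ifs with hj
  · rw [children_split_left_getElem? h]
    exact ⟨fun e => ⟨by omega, e.2⟩, fun e => ⟨by omega, e.2⟩⟩
  · exact ⟨fun e => by simp at e, fun e => by omega⟩

theorem children_split_head? (v : D.Node) :
    b.head? = some v ↔ v.1 = p.1 ++ [a.length + 1] := by
  rw [List.head?_eq_getElem?, children_split_right_getElem? h]

theorem children_split_mem_tail (v : D.Node) :
    v ∈ b.tail ↔ ∃ j, a.length + 1 < j ∧ v.1 = p.1 ++ [j] := by
  rw [List.mem_iff_getElem?]
  simp only [List.getElem?_tail, children_split_right_getElem? h]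
  constructor
  · exact fun ⟨i, e⟩ => ⟨_, by omega, e⟩
  · rintro ⟨j, hj, e⟩
    exact ⟨j - (a.length + 2), by rw [e, show a.length + 1 + (j - (a.length + 2) + 1) = j by omega]⟩

end TreeDomain

/-! ### Labels of all nodes with their relative positions -/

section Neighbourhood
variable {X : Type u} {D : TreeDomain}

/-- The labels in the subtree of `u`, with their positions relative to `u`. -/
def insideInfo (x : D.Node → X) (u : D.Node) : Set (X × NodeRel) :=
  {p | ∃ v : D.Node, u.1 <+: v.1 ∧ p = (x v, nodeRel u.1 v.1)}

/-- The labels outside of the subtree of `u`, with their positions relative to `u`. -/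
def outsideInfo (x : D.Node → X) (u : D.Node) : Set (X × NodeRel) :=
  {p | ∃ v : D.Node, ¬ u.1 <+: v.1 ∧ p = (x v, nodeRel u.1 v.1)}

/-- The label of `u` with the labels of all nodes and their positions relative to `u`. -/
def nbhd (x : D.Node → X) (u : D.Node) : X × Set (X × NodeRel) :=
  (x u, {p | ∃ v : D.Node, p = (x v, nodeRel u.1 v.1)})

theorem nbhd_eq (x : D.Node → X) (u : D.Node) :
    nbhd x u = (x u, insideInfo x u ∪ outsideInfo x u) := by
  unfold nbhd insideInfo outsideInfo
  congr 1
  ext p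
  simp only [Set.mem_union, Set.mem_ofPred_eq, ← exists_or, ← or_and_right, em, true_and]

/-- Computes `insideInfo` from the values at the children. -/
def insideStep (a : X) (S : Set (Set (X × NodeRel))) : Set (X × NodeRel) :=
  {p | p = (a, .eq) ∨ ∃ I ∈ S, ∃ q ∈ I, p = (q.1, if q.2 = .eq then .child else .far)}

/-- Computes `outsideInfo` from the value at the parent and the values of `insideInfo` at the
siblings. -/
def outsideStep (a : X) (O : Set (X × NodeRel))
    (l r : Option (Set (X × NodeRel)) × Set (Set (X × NodeRel))) : Set (X × NodeRel) :=
  {p | p = (a, .parent) ∨ (∃ q ∈ O, p = (q.1, .far)) ∨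
    (∃ I, l.1 = some I ∧ ∃ q ∈ I, p = (q.1, if q.2 = .eq then .prev else .far)) ∨
    (∃ I ∈ l.2, ∃ q ∈ I, p = (q.1, .far)) ∨
    (∃ I, r.1 = some I ∧ ∃ q ∈ I, p = (q.1, if q.2 = .eq then .next else .far)) ∨
    (∃ I ∈ r.2, ∃ q ∈ I, p = (q.1, .far))}

/-- A proper descendant of `u` lies below exactly one child. Seen from `u` it is a child if it is
that child itself, and far otherwise. -/
theorem insideInfo_eq (x : D.Node → X) (u : D.Node) :
    insideInfo x u = insideStep (x u) {I | I ∈ (D.children u).map (insideInfo x)} := by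
  ext p
  simp only [insideInfo, insideStep, Set.mem_ofPred_eq, List.mem_map]
  constructor
  · rintro ⟨v, ⟨w, hw⟩, rfl⟩
    cases w with
    | nil =>
      left
      have : u = v := Subtype.ext (by simpa using hw)
      rw [this, nodeRel_self]
    | cons i w =>
      right
      have hw' : (u.1 ++ [i]) ++ w = v.1 := by rw [← hw]; simp
      have hc : u.1 ++ [i] ∈ D.nodes := D.prefix_closed _ _ v.2 ⟨w, hw'⟩
      refine ⟨_, ⟨⟨u.1 ++ [i], hc⟩, (D.isChild_iff _ _).1 ⟨i, rfl⟩, rfl⟩, _,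
        ⟨v, ⟨w, hw'⟩, rfl⟩, ?_⟩
      simp only [nodeRel_eq_iff]
      rw [← hw']
      cases w with
      | nil => simp [nodeRel_child]
      | cons => rw [if_neg (by simp), nodeRel_far_of_length (by simp)]
  · rintro (rfl | ⟨_, ⟨c, hc, rfl⟩, _, ⟨v, ⟨w, hv⟩, rfl⟩, rfl⟩)
    · exact ⟨u, List.prefix_refl _, by rw [nodeRel_self]⟩
    · obtain ⟨i, hi⟩ := (D.isChild_iff _ _).2 hc
      refine ⟨v, ⟨i :: w, by rw [← hv, hi]; simp⟩, ?_⟩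
      simp only [nodeRel_eq_iff]
      rw [← hv, hi]
      cases w with
      | nil => simp [nodeRel_child]
      | cons => rw [if_neg (by simp), nodeRel_far_of_length (by simp)]

theorem prefix_sibling_cases {p v : List ℕ} {i : ℕ} (h : ¬ (p ++ [i]) <+: v) :
    ¬ p <+: v ∨ v = p ∨ ∃ j w, j ≠ i ∧ v = p ++ [j] ++ w := by
  by_cases hp : p <+: v
  · right
    obtain ⟨w, rfl⟩ := hp
    cases w with
    | nil => left; simp
    | cons j w =>
      right
      refine ⟨j, w, ?_, by simp⟩
      rintro rfl
      exact h ⟨w, by simp⟩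
  · exact Or.inl hp

theorem not_prefix_sibling {p w : List ℕ} {i j : ℕ} (h : j ≠ i) :
    ¬ (p ++ [i]) <+: p ++ [j] ++ w := by
  rintro ⟨w', e⟩
  simp at e
  exact h e.1.symm

theorem nodeRel_sibling_append (p w : List ℕ) {i j : ℕ} (h : j ≠ i) :
    nodeRel (p ++ [i]) (p ++ [j] ++ w) = if nodeRel (p ++ [j]) (p ++ [j] ++ w) = .eq then
      (if j = i + 1 then .next else if i = j + 1 then .prev else .far) else .far := by
  cases w with
  | nil => rw [List.append_nil, nodeRel_self, if_pos rfl, nodeRel_sibling p h]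
  | cons k w =>
    rw [if_neg (by rw [nodeRel_eq_iff]; simp), nodeRel_far_of_nephew p _ h (by simp)]

/-- A node not below `c` is the parent, lies outside the subtree of the parent, or lies below a
sibling of `c`. Only the parent and the two adjacent siblings themselves are not far, which is why
contexts that single out the adjacent letter are enough. -/
theorem outsideInfo_eq (x : D.Node → X) {p c : D.Node} {a b : List D.Node}
    (h : D.children p = a ++ c :: b) :
    outsideInfo x c = outsideStep (x p) (outsideInfo x p) (leftContext (a.map (insideInfo x)))
      (rightContext (b.map (insideInfo x))) := by
  have hc := TreeDomain.children_split_mid h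
  -- Here `r` is the position, relative to `c`, of the sibling `s` with index `j`; every proper
  -- descendant of `s` is far.
  have far_of : ∀ {j : ℕ} {v : D.Node} {r : NodeRel}, j ≠ a.length →
      (j = a.length + 1 → r = .next) → (a.length = j + 1 → r = .prev) →
      (j ≠ a.length + 1 → a.length ≠ j + 1 → r = .far) → ∀ s : D.Node, s.1 = p.1 ++ [j] →
      s.1 <+: v.1 → ¬ c.1 <+: v.1 ∧
        nodeRel c.1 v.1 = if nodeRel s.1 v.1 = .eq then r else .far := by
    rintro j v r hj h1 h2 h3 s hs ⟨w, hw⟩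
    rw [← hw, hs, hc]
    refine ⟨not_prefix_sibling hj, ?_⟩
    rw [nodeRel_sibling_append _ _ hj]
    congr 1
    split_ifs with e1 e2
    · exact (h1 e1).symm
    · exact (h2 e2).symm
    · exact (h3 e1 e2).symm
  ext q
  simp only [outsideStep, leftContext, rightContext, Set.mem_ofPred_eq, List.getLast?_map,
    List.head?_map, Option.map_eq_some_iff, ← List.map_dropLast, ← List.map_tail, List.mem_map,
    TreeDomain.children_split_getLast? h, TreeDomain.children_split_mem_dropLast h,
    TreeDomain.children_split_head? h, TreeDomain.children_split_mem_tail h]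
  constructor
  · rintro ⟨v, hv, rfl⟩
    rw [hc] at hv
    rcases prefix_sibling_cases hv with h1 | h1 | ⟨j, w, hj, h1⟩
    · exact Or.inr (Or.inl ⟨_, ⟨v, h1, rfl⟩, by rw [hc, nodeRel_far_of_not_prefix _ h1]⟩)
    · left
      rw [hc, h1, nodeRel_parent]
      rw [Subtype.ext h1]
    · have hs : p.1 ++ [j] ∈ D.nodes := D.prefix_closed _ _ v.2 ⟨w, h1.symm⟩
      have hsv : p.1 ++ [j] <+: v.1 := ⟨w, h1.symm⟩
      right; right
      rcases lt_trichotomy j a.length with hlt | heq | hgt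
      · by_cases hl : a.length = j + 1
        · left
          refine ⟨_, ⟨⟨_, hs⟩, ⟨j, hl, rfl⟩, rfl⟩, _, ⟨v, hsv, rfl⟩, ?_⟩
          rw [(far_of (v := v) (r := .prev) hj (by omega) (by simp) (by omega) ⟨_, hs⟩ rfl hsv).2]
        · right; left
          refine ⟨_, ⟨⟨_, hs⟩, ⟨j, by omega, rfl⟩, rfl⟩, _, ⟨v, hsv, rfl⟩, ?_⟩
          rw [(far_of (v := v) (r := .far) hj (by omega) (by omega) (by simp) ⟨_, hs⟩ rfl hsv).2,
            ite_self]
      · exact absurd heq hj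
      · right; right
        by_cases hl : j = a.length + 1
        · left
          refine ⟨_, ⟨⟨_, hs⟩, congrArg (fun k => p.1 ++ [k]) hl, rfl⟩, _, ⟨v, hsv, rfl⟩, ?_⟩
          rw [(far_of (v := v) (r := .next) hj (by simp) (by omega) (by omega) ⟨_, hs⟩ rfl hsv).2]
        · right
          refine ⟨_, ⟨⟨_, hs⟩, ⟨j, by omega, rfl⟩, rfl⟩, _, ⟨v, hsv, rfl⟩, ?_⟩
          rw [(far_of (v := v) (r := .far) hj (by omega) (by omega) (by simp) ⟨_, hs⟩ rfl hsv).2,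
            ite_self]
  · rintro (rfl | ⟨_, ⟨v, hv, rfl⟩, rfl⟩ | ⟨_, ⟨s, ⟨j, hj, hs⟩, rfl⟩, _, ⟨v, hv, rfl⟩, rfl⟩ |
      ⟨_, ⟨s, ⟨j, hj, hs⟩, rfl⟩, _, ⟨v, hv, rfl⟩, rfl⟩ |
      ⟨_, ⟨s, hs, rfl⟩, _, ⟨v, hv, rfl⟩, rfl⟩ |
      ⟨_, ⟨s, ⟨j, hj, hs⟩, rfl⟩, _, ⟨v, hv, rfl⟩, rfl⟩)
    · refine ⟨p, ?_, by rw [hc, nodeRel_parent]⟩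
      rw [hc]
      intro e
      have := e.length_le
      simp at this
    · refine ⟨v, ?_, by rw [hc, nodeRel_far_of_not_prefix _ hv]⟩
      rw [hc]
      exact fun e => hv ((List.prefix_append _ _).trans e)
    · have := far_of (v := v) (r := .prev) (by omega) (by omega) (by simp) (by omega) s hs hv
      exact ⟨v, this.1, by rw [this.2]⟩
    · have := far_of (v := v) (r := .far) (by omega) (by omega) (by omega) (by simp) s hs hv
      exact ⟨v, this.1, by rw [this.2, ite_self]⟩
    · have := far_of (v := v) (r := .next) (by omega) (by simp) (by omega) (by omega) s hs hv
      exact ⟨v, this.1, by rw [this.2]⟩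
    · have := far_of (v := v) (r := .far) (by omega) (by omega) (by omega) (by simp) s hs hv
      exact ⟨v, this.1, by rw [this.2, ite_self]⟩

theorem outsideInfo_root (x : D.Node → X) : outsideInfo x D.root = ∅ := by
  ext p
  simp [outsideInfo, TreeDomain.root]

/-- The equations determine `I` from the leaves upwards. -/
theorem insideInfo_unique (x : D.Node → X) (I : D.Node → Set (X × NodeRel))
    (h : ∀ u, I u = insideStep (x u) {J | J ∈ (D.children u).map I}) : I = insideInfo x := by
  -- The number `n` bounds the height left below `u`; for `n = 0` no node is that deep.
  have key : ∀ n, ∀ u : D.Node, D.nodes.sup List.length < u.1.length + n → I u = insideInfo x u := by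
    intro n
    induction n with
    | zero =>
      intro u hu
      have : u.1.length ≤ D.nodes.sup List.length := Finset.le_sup (f := List.length) u.2
      omega
    | succ n ih =>
      intro u hu
      rw [h u, insideInfo_eq]
      have : (D.children u).map I = (D.children u).map (insideInfo x) := by
        refine List.map_congr_left fun c hc => ih c ?_
        obtain ⟨i, hi⟩ := (D.isChild_iff _ _).2 hc
        rw [hi, List.length_append, List.length_singleton]
        omega
      rw [this]
  exact funext fun u => key (D.nodes.sup List.length + 1) u (by omega)

/-- The equations determine `O` from the root downwards, once `insideInfo` is known at the siblings.
-/
theorem outsideInfo_unique (x : D.Node → X) (O : D.Node → Set (X × NodeRel))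
    (h0 : O D.root = ∅)
    (h : ∀ p c a b, D.children p = a ++ c :: b → O c = outsideStep (x p) (O p)
      (leftContext (a.map (insideInfo x))) (rightContext (b.map (insideInfo x)))) :
    O = outsideInfo x := by
  have key : ∀ (w : List ℕ) (hw : w ∈ D.nodes), O ⟨w, hw⟩ = outsideInfo x ⟨w, hw⟩ := by
    intro w
    induction w using List.reverseRecOn with
    | nil => exact fun _ => h0.trans (outsideInfo_root x).symm
    | append_singleton p i ih =>
      intro hw
      have hp : p ∈ D.nodes := D.prefix_closed _ _ hw (List.prefix_append _ _)
      have hc := (D.isChild_iff ⟨p, hp⟩ ⟨p ++ [i], hw⟩).1 ⟨i, rfl⟩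
      obtain ⟨a, b, e⟩ := List.append_of_mem hc
      rw [h _ _ _ _ e, outsideInfo_eq x e, ih hp]
  exact funext fun u => key u.1 u.2

/-- The transducer that computes `nbhd`. -/
def nbhdTransducer (X : Type) [Finite X] : TreeTransducer X (X × Set (X × NodeRel)) where
  automaton :=
    -- The components guess the label, the inside set and the outside set. The last guess is
    -- verified at the parent, where all siblings are visible; at the root the final states force it
    -- to be empty.
    { State := X × Set (X × NodeRel) × Set (X × NodeRel)
      finite_state := inferInstance
      trans := fun q x => ({w | (q.1 = x ∧ q.2.1 = insideStep x {I | I ∈ w.map (fun q => q.2.1)}) ∧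
        ∀ a c b, w = a ++ c :: b → c.2.2 = outsideStep x q.2.2
          (leftContext (a.map (fun q => q.2.1))) (rightContext (b.map (fun q => q.2.1)))} :
        Set (List _))
      regular_trans := fun q x => isRegular_contexts
        (fun q : X × Set (X × NodeRel) × Set (X × NodeRel) => q.2.1)
        (fun S => q.1 = x ∧ q.2.1 = insideStep x S) (fun l c r => c.2.2 = outsideStep x q.2.2 l r)
      final := {q | q.2.2 = ∅} }
  output := {p | p.2.2 = (p.1.1, p.1.2.1 ∪ p.1.2.2)}

theorem nbhdTransducer_isOutput {X : Type} [Finite X] (x : D.Node → X)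
    (y : D.Node → X × Set (X × NodeRel)) :
    (nbhdTransducer X).IsOutput ⟨D, x⟩ y ↔ y = nbhd x := by
  constructor
  · rintro ⟨(r : D.Node → X × Set (X × NodeRel) × Set (X × NodeRel)), ⟨hr, hf⟩, ho⟩
    have hx : ∀ u, (r u).1 = x u := fun u => (hr u).1.1
    have hI : (fun u => (r u).2.1) = insideInfo x := by
      refine insideInfo_unique x _ fun u => ?_
      have : (r u).2.1 = insideStep (x u) {I | I ∈ ((D.children u).map r).map (fun q => q.2.1)} :=
        (hr u).1.2
      rwa [List.map_map] at this
    have hO : (fun u => (r u).2.2) = outsideInfo x := by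
      refine outsideInfo_unique x _ hf fun p c a b e => ?_
      have := (hr p).2 (a.map r) (r c) (b.map r) (by
        change (D.children p).map r = _
        rw [e, List.map_append, List.map_cons])
      rw [List.map_map, List.map_map] at this
      rw [← hI]
      exact this
    funext u
    refine (ho u).trans ?_
    rw [nbhd_eq, ← hI, ← hO]
    exact Prod.ext (hx u) rfl
  · rintro rfl
    let r : D.Node → X × Set (X × NodeRel) × Set (X × NodeRel) :=
      fun u => (x u, insideInfo x u, outsideInfo x u)
    refine ⟨r, ⟨fun u => ⟨⟨rfl, ?_⟩, ?_⟩, outsideInfo_root x⟩, fun u => nbhd_eq x u⟩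
    · change (r u).2.1 = insideStep (x u) {I | I ∈ ((D.children u).map r).map (fun q => q.2.1)}
      rw [List.map_map]
      exact insideInfo_eq x u
    · intro a c b (e : (D.children u).map r = _)
      obtain ⟨a', r, ha, rfl, hr⟩ := List.map_eq_append_iff.1 e
      obtain ⟨c', b', rfl, rfl, rfl⟩ := List.map_eq_cons_iff.1 hr
      change (r c').2.2 = outsideStep (x u) (r u).2.2
        (leftContext ((a'.map r).map (fun q => q.2.1)))
        (rightContext ((b'.map r).map (fun q => q.2.1)))
      rw [List.map_map, List.map_map]
      exact outsideInfo_eq x ha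

end Neighbourhood

/-! ## Two-variable logic with the child and next-sibling relations -/

theorem FO.sat_congr {V : Type u} {P : Type v} {O : Set BinRel} [DecidableEq V] {A : Type w}
    (t : DataTree A) (I : P → Set t.dom.Node) (φ : FO V P O) {s s' : V → t.dom.Node}
    (h : ∀ x ∈ φ.freeVars, s x = s' x) : φ.Sat t I s ↔ φ.Sat t I s' := by
  induction φ generalizing s s' with
  | eq x y => simp only [Sat, h x (by simp [freeVars]), h y (by simp [freeVars])]
  | pred p x => simp only [Sat, h x (by simp [freeVars])]
  | rel R hR x y => simp only [Sat, h x (by simp [freeVars]), h y (by simp [freeVars])]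
  | neg φ ih => exact not_congr (ih h)
  | conj φ ψ ih1 ih2 =>
    exact and_congr (ih1 fun x hx => h x (Or.inl hx)) (ih2 fun x hx => h x (Or.inr hx))
  | disj φ ψ ih1 ih2 =>
    exact or_congr (ih1 fun x hx => h x (Or.inl hx)) (ih2 fun x hx => h x (Or.inr hx))
  | all x φ ih =>
    refine forall_congr' fun n => ih fun y hy => ?_
    by_cases e : y = x
    · subst e; simp
    · simp only [Function.update_of_ne e]
      exact h y ⟨hy, e⟩
  | ex x φ ih =>
    refine exists_congr fun n => ih fun y hy => ?_
    by_cases e : y = x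
    · subst e; simp
    · simp only [Function.update_of_ne e]
      exact h y ⟨hy, e⟩

theorem FO.IsSentence.models_iff {V : Type u} {P : Type v} {O : Set BinRel} [DecidableEq V]
    {A : Type w} {t : DataTree A} {I : P → Set t.dom.Node} {φ : FO V P O} (h : φ.IsSentence)
    (s : V → t.dom.Node) : φ.Models t I ↔ φ.Sat t I s :=
  ⟨fun hm => hm s, fun hs s' => (φ.sat_congr t I fun x hx => by
    rw [show φ.freeVars = ∅ from h] at hx; exact hx.elim).1 hs⟩

/-- The types of nodes up to `k` quantifiers. -/
def IterNbhd (L : Type) : ℕ → Type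
  | 0 => L
  | k + 1 => IterNbhd L k × Set (IterNbhd L k × NodeRel)

instance IterNbhd.finite (L : Type) [Finite L] : ∀ k, Finite (IterNbhd L k)
  | 0 => ‹Finite L›
  | k + 1 => by
    have := IterNbhd.finite L k
    exact inferInstanceAs (Finite (IterNbhd L k × Set (IterNbhd L k × NodeRel)))

/-- The `k`-fold iteration of `nbhd`. -/
def iterNbhd {L : Type} {D : TreeDomain} (x : D.Node → L) : ∀ k, D.Node → IterNbhd L k
  | 0 => x
  | k + 1 => nbhd (iterNbhd x k)

/-- The label recorded in an iterated neighbourhood. -/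
def IterNbhd.label {L : Type} : ∀ {k}, IterNbhd L k → L
  | 0, a => a
  | _ + 1, a => IterNbhd.label a.1

theorem iterNbhd_label {L : Type} {D : TreeDomain} (x : D.Node → L) (k : ℕ) (u : D.Node) :
    (iterNbhd x k u).label = x u := by
  induction k with
  | zero => rfl
  | succ k ih => exact ih

/-- The relative position of two of the two variables. -/
def varRel (x y : Fin 2) (r : NodeRel) : NodeRel :=
  if x = y then .eq else if x = 0 then r else r.symm

theorem varRel_eq {D : TreeDomain} (s : Fin 2 → D.Node) (x y : Fin 2) :
    varRel x y (nodeRel (s 0).1 (s 1).1) = nodeRel (s x).1 (s y).1 := by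
  fin_cases x <;> fin_cases y <;> simp [varRel, nodeRel_self, ← nodeRel_symm]

/-- The truth value of `φ` is a function of the iterated neighbourhoods of the two nodes and of
their relative position. -/
def FO.DeterminedAt {L : Type} {P : Type v} {O : Set BinRel} (A : Type w) (pr : P → L → Prop)
    (φ : FO (Fin 2) P O) (k : ℕ) : Prop :=
  ∃ f : IterNbhd L k → IterNbhd L k → NodeRel → Prop, ∀ (t : DataTree A) (x : t.dom.Node → L)
    (s : Fin 2 → t.dom.Node), φ.Sat t (fun p => {u | pr p (x u)}) s ↔
      f (iterNbhd x k (s 0)) (iterNbhd x k (s 1)) (nodeRel (s 0).1 (s 1).1)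

theorem FO.DeterminedAt.mono {L : Type} {P : Type v} {O : Set BinRel} {A : Type w}
    {pr : P → L → Prop} {φ : FO (Fin 2) P O} {k l : ℕ} (h : φ.DeterminedAt A pr k) (hkl : k ≤ l) :
    φ.DeterminedAt A pr l := by
  induction l, hkl using Nat.le_induction with
  | base => exact h
  | succ l _ ih =>
    obtain ⟨f, hf⟩ := ih
    exact ⟨fun a b r => f a.1 b.1 r, hf⟩

theorem forall_mem_nbhd {X : Type u} {D : TreeDomain} (x : D.Node → X) (u : D.Node)
    (F : X × NodeRel → Prop) :
    (∀ q ∈ (nbhd x u).2, F q) ↔ ∀ v : D.Node, F (x v, nodeRel u.1 v.1) :=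
  ⟨fun h v => h _ ⟨v, rfl⟩, by rintro h _ ⟨v, rfl⟩; exact h v⟩

theorem exists_mem_nbhd {X : Type u} {D : TreeDomain} (x : D.Node → X) (u : D.Node)
    (F : X × NodeRel → Prop) :
    (∃ q ∈ (nbhd x u).2, F q) ↔ ∃ v : D.Node, F (x v, nodeRel u.1 v.1) :=
  ⟨by rintro ⟨_, ⟨v, rfl⟩, h⟩; exact ⟨v, h⟩, fun ⟨v, h⟩ => ⟨_, ⟨v, rfl⟩, h⟩⟩

/-- By induction on the formula, where each quantifier costs one level of iteration. -/
theorem FO.exists_determinedAt {L : Type} {P : Type v} (A : Type w) (pr : P → L → Prop)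
    (φ : FO (Fin 2) P {BinRel.child, BinRel.nextSibling}) : ∃ k, φ.DeterminedAt A pr k := by
  induction φ with
  | eq x y =>
    refine ⟨0, fun _ _ r => varRel x y r = .eq, fun t lab s => ?_⟩
    change s x = s y ↔ varRel x y _ = .eq
    rw [varRel_eq, nodeRel_eq_iff]
    exact Subtype.ext_iff
  | pred p x =>
    refine ⟨0, fun a b _ => pr p (if x = 0 then a else b), fun t lab s => ?_⟩
    fin_cases x <;> rfl
  | rel R hR x y =>
    rcases hR with rfl | rfl
    · refine ⟨0, fun _ _ r => varRel x y r = .child, fun t lab s => ?_⟩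
      change _ ↔ varRel x y _ = .child
      rw [varRel_eq]
      exact (nodeRel_eq_child_iff _ _).symm
    · refine ⟨0, fun _ _ r => varRel x y r = .next, fun t lab s => ?_⟩
      change _ ↔ varRel x y _ = .next
      rw [varRel_eq]
      exact (nodeRel_eq_next_iff _ _).symm
  | neg φ ih =>
    obtain ⟨k, f, hf⟩ := ih
    exact ⟨k, fun a b r => ¬ f a b r, fun t x s => not_congr (hf t x s)⟩
  | conj φ ψ ih1 ih2 =>
    obtain ⟨k, h1⟩ := ih1
    obtain ⟨l, h2⟩ := ih2
    obtain ⟨f, hf⟩ := h1.mono (le_max_left k l)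
    obtain ⟨g, hg⟩ := h2.mono (le_max_right k l)
    exact ⟨_, fun a b r => f a b r ∧ g a b r, fun t x s => and_congr (hf t x s) (hg t x s)⟩
  | disj φ ψ ih1 ih2 =>
    obtain ⟨k, h1⟩ := ih1
    obtain ⟨l, h2⟩ := ih2
    obtain ⟨f, hf⟩ := h1.mono (le_max_left k l)
    obtain ⟨g, hg⟩ := h2.mono (le_max_right k l)
    exact ⟨_, fun a b r => f a b r ∨ g a b r, fun t x s => or_congr (hf t x s) (hg t x s)⟩
  | all x φ ih =>
    obtain ⟨k, f, hf⟩ := ih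
    -- Requantifying one variable discards its old node, so only the type of the other node matters;
    -- its second component lists the types and positions of all candidates. Positions there are
    -- relative to the fixed node, hence the inversion when variable `0` is quantified.
    refine ⟨k + 1, fun a b _ => if x = 0 then ∀ q ∈ b.2, f q.1 b.1 q.2.symm
      else ∀ q ∈ a.2, f a.1 q.1 q.2, fun t lab s => ?_⟩
    have h : ∀ n, φ.Sat t (fun p => {u | pr p (lab u)}) (Function.update s x n) ↔ _ :=
      fun n => hf t lab _
    refine (forall_congr' h).trans ?_
    fin_cases x
    · exact Iff.trans (by simp [← nodeRel_symm]) (forall_mem_nbhd (iterNbhd lab k) (s 1)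
        (fun q => f q.1 (iterNbhd lab k (s 1)) q.2.symm)).symm
    · exact Iff.trans (by simp) (forall_mem_nbhd (iterNbhd lab k) (s 0)
        (fun q => f (iterNbhd lab k (s 0)) q.1 q.2)).symm
  | ex x φ ih =>
    obtain ⟨k, f, hf⟩ := ih
    refine ⟨k + 1, fun a b _ => if x = 0 then ∃ q ∈ b.2, f q.1 b.1 q.2.symm
      else ∃ q ∈ a.2, f a.1 q.1 q.2, fun t lab s => ?_⟩
    have h : ∀ n, φ.Sat t (fun p => {u | pr p (lab u)}) (Function.update s x n) ↔ _ :=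
      fun n => hf t lab _
    refine (exists_congr h).trans ?_
    fin_cases x
    · exact Iff.trans (by simp [← nodeRel_symm]) (exists_mem_nbhd (iterNbhd lab k) (s 1)
        (fun q => f q.1 (iterNbhd lab k (s 1)) q.2.symm)).symm
    · exact Iff.trans (by simp) (exists_mem_nbhd (iterNbhd lab k) (s 0)
        (fun q => f (iterNbhd lab k (s 0)) q.1 q.2)).symm

theorem exists_iterNbhd_transducer (L : Type) [Finite L] (k : ℕ) :
    ∃ T : TreeTransducer L (IterNbhd L k), ∀ (D : TreeDomain) (x : D.Node → L)
      (y : D.Node → IterNbhd L k), T.IsOutput ⟨D, x⟩ y ↔ y = iterNbhd x k := by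
  induction k with
  | zero =>
    refine ⟨TreeTransducer.relabel fun a b => b = a, fun D x y => ?_⟩
    rw [TreeTransducer.relabel_isOutput]
    exact funext_iff.symm
  | succ k ih =>
    obtain ⟨T, hT⟩ := ih
    refine ⟨T.comp (nbhdTransducer (IterNbhd L k)), fun D x y => ?_⟩
    refine (TreeTransducer.comp_isOutput _ _ _ _ _).trans ?_
    simp only [hT, exists_eq_left]
    exact nbhdTransducer_isOutput _ _

/-- A sentence of two-variable logic over the child and next-sibling relations is checked by a
transducer. -/
theorem FO.IsSentence.exists_transducer {L : Type} [Finite L] {P : Type v} (A : Type w)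
    (pr : P → L → Prop) {φ : FO (Fin 2) P {BinRel.child, BinRel.nextSibling}}
    (hφ : φ.IsSentence) :
    ∃ T : TreeTransducer L L, ∀ (t : DataTree A) (x y : t.dom.Node → L),
      T.IsOutput ⟨t.dom, x⟩ y ↔ y = x ∧ φ.Models t (fun p => {u | pr p (x u)}) := by
  obtain ⟨k, f, hf⟩ := φ.exists_determinedAt A pr
  obtain ⟨T, hT⟩ := exists_iterNbhd_transducer L k
  -- A sentence may be evaluated with both variables at the root, so its truth is a property of the
  -- root's type alone.
  refine ⟨(T.comp (TreeTransducer.rootCheck fun a => f a a .eq)).comp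
    (TreeTransducer.relabel fun a b => b = a.label), fun t x y => ?_⟩
  rw [TreeTransducer.comp_isOutput]
  simp only [TreeTransducer.comp_isOutput, TreeTransducer.relabel_isOutput, hT, exists_eq_left,
    TreeTransducer.rootCheck_isOutput]
  rw [hφ.models_iff fun _ => t.dom.root, hf, nodeRel_self]
  constructor
  · rintro ⟨_, ⟨rfl, h⟩, hy⟩
    exact ⟨funext fun u => (hy u).trans (iterNbhd_label x k u), h⟩
  · rintro ⟨rfl, h⟩
    exact ⟨_, ⟨rfl, h⟩, fun u => (iterNbhd_label y k u).symm⟩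

/-! ## First-order logic of the data values -/

/-- A set with labels and a binary relation. -/
structure LabeledRel (L : Type) where
  carrier : Type
  lab : carrier → L
  lt : carrier → carrier → Prop

namespace LabeledRel
variable {L : Type}

/-- Interpretation of the relations `∼`, `≺`, `≺_suc`. -/
def Holds (M : LabeledRel L) : BinRel → M.carrier → M.carrier → Prop
  | .dataEq, a, b => ¬ M.lt a b ∧ ¬ M.lt b a
  | .dataLt, a, b => M.lt a b
  | .dataSuc, a, b => M.lt a b ∧ ∀ c, ¬ (M.lt a c ∧ M.lt c b)
  | _, _, _ => False

/-- Satisfaction under a partial assignment. -/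
def Sat (M : LabeledRel L) {P : Type v} {O : Set BinRel} (pr : P → L → Prop) :
    FO ℕ P O → (ℕ → Option M.carrier) → Prop
  | .eq x y, s => ∃ a, s x = some a ∧ s y = some a
  | .pred p x, s => ∃ a, s x = some a ∧ pr p (M.lab a)
  | .rel R _ x y, s => ∃ a b, s x = some a ∧ s y = some b ∧ M.Holds R a b
  | .neg φ, s => ¬ M.Sat pr φ s
  | .conj φ ψ, s => M.Sat pr φ s ∧ M.Sat pr ψ s
  | .disj φ ψ, s => M.Sat pr φ s ∨ M.Sat pr ψ s
  | .all x φ, s => ∀ a, M.Sat pr φ (Function.update s x (some a))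
  | .ex x φ, s => ∃ a, M.Sat pr φ (Function.update s x (some a))

theorem sat_congr (M : LabeledRel L) {P : Type v} {O : Set BinRel} (pr : P → L → Prop)
    (φ : FO ℕ P O) {s s' : ℕ → Option M.carrier} (h : ∀ x ∈ φ.freeVars, s x = s' x) :
    M.Sat pr φ s ↔ M.Sat pr φ s' := by
  induction φ generalizing s s' with
  | eq x y => simp only [Sat, h x (by simp [FO.freeVars]), h y (by simp [FO.freeVars])]
  | pred p x => simp only [Sat, h x (by simp [FO.freeVars])]
  | rel R hR x y => simp only [Sat, h x (by simp [FO.freeVars]), h y (by simp [FO.freeVars])]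
  | neg φ ih => exact not_congr (ih h)
  | conj φ ψ ih1 ih2 =>
    exact and_congr (ih1 fun x hx => h x (Or.inl hx)) (ih2 fun x hx => h x (Or.inr hx))
  | disj φ ψ ih1 ih2 =>
    exact or_congr (ih1 fun x hx => h x (Or.inl hx)) (ih2 fun x hx => h x (Or.inr hx))
  | all x φ ih =>
    refine forall_congr' fun n => ih fun y hy => ?_
    by_cases e : y = x
    · subst e; simp
    · simp only [Function.update_of_ne e]
      exact h y ⟨hy, e⟩
  | ex x φ ih =>
    refine exists_congr fun n => ih fun y hy => ?_
    by_cases e : y = x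
    · subst e; simp
    · simp only [Function.update_of_ne e]
      exact h y ⟨hy, e⟩

/-- The nodes of an ordered-data tree with the order of the data values. -/
def ofTree {A : Type u} (t : DataTree A) (x : t.dom.Node → L) : LabeledRel L :=
  ⟨t.dom.Node, x, fun a b => t.val a < t.val b⟩

/-- Data values are linearly ordered, so having the same value means being incomparable; the order
alone therefore carries all three relations. -/
theorem sat_ofTree {A : Type u} (t : DataTree A) (x : t.dom.Node → L) {P : Type v}
    (pr : P → L → Prop) (φ : FO ℕ P {BinRel.dataEq, BinRel.dataLt, BinRel.dataSuc})
    (s : ℕ → t.dom.Node) :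
    (ofTree t x).Sat pr φ (fun v => some (s v)) ↔ φ.Sat t (fun p => {u | pr p (x u)}) s := by
  have hupd : ∀ (s : ℕ → t.dom.Node) (v : ℕ) (a : t.dom.Node),
      Function.update (fun v => some (s v)) v (some a) =
        fun w => some (Function.update s v a w) := fun s v a => by
    funext w
    by_cases e : w = v
    · subst e; simp
    · simp [e]
  induction φ generalizing s with
  | eq x y => exact ⟨fun ⟨a, h1, h2⟩ => (Option.some.inj h1).trans (Option.some.inj h2).symm,
      fun h => ⟨s x, rfl, congrArg some (Eq.symm h)⟩⟩
  | pred p x => simp [Sat, FO.Sat, ofTree]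
  | rel R hR y z =>
    have : (∃ a b, some (s y) = some a ∧ some (s z) = some b ∧ (ofTree t x).Holds R a b) ↔
        (ofTree t x).Holds R (s y) (s z) := by simp
    refine this.trans ?_
    rcases hR with rfl | rfl | rfl
    · change (¬ t.val (s y) < t.val (s z) ∧ ¬ t.val (s z) < t.val (s y)) ↔
        t.val (s y) = t.val (s z)
      omega
    · exact Iff.rfl
    · refine and_congr Iff.rfl (forall_congr' fun c => ?_)
      change ¬ (t.val (s y) < t.val c ∧ t.val c < t.val (s z)) ↔
        (t.val (s y) < t.val c → t.val (s z) ≤ t.val c)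
      omega
  | neg φ ih => exact not_congr (ih s)
  | conj φ ψ ih1 ih2 => exact and_congr (ih1 s) (ih2 s)
  | disj φ ψ ih1 ih2 => exact or_congr (ih1 s) (ih2 s)
  | all v φ ih =>
    refine forall_congr' fun a => ?_
    exact (iff_of_eq (congrArg _ (hupd s v a))).trans (ih _)
  | ex v φ ih =>
    refine exists_congr fun a => ?_
    exact (iff_of_eq (congrArg _ (hupd s v a))).trans (ih _)

/-- Atomic types of the variables below `N`. -/
abbrev AtomType (L : Type) (N : ℕ) : Type :=
  (Fin N → Option L) × (Fin N → Fin N → Prop) × (Fin N → Fin N → Prop)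

/-- Types of the variables below `N` up to `k` quantifiers. -/
def HintikkaType (L : Type) (N : ℕ) : ℕ → Type
  | 0 => AtomType L N
  | k + 1 => AtomType L N × (Fin N → Set (HintikkaType L N k))

instance HintikkaType.finite (L : Type) [Finite L] (N : ℕ) : ∀ k, Finite (HintikkaType L N k)
  | 0 => inferInstanceAs (Finite (AtomType L N))
  | k + 1 => by
    have := HintikkaType.finite L N k
    exact inferInstanceAs (Finite (AtomType L N × (Fin N → Set (HintikkaType L N k))))

/-- The atomic type of an assignment. -/
def atomType (M : LabeledRel L) (N : ℕ) (s : ℕ → Option M.carrier) : AtomType L N :=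
  (fun v => (s v).map M.lab, fun v w => ∃ a, s v = some a ∧ s w = some a,
    fun v w => ∃ a b, s v = some a ∧ s w = some b ∧ M.lt a b)

/-- The type of an assignment up to `k` quantifiers. -/
def hintikkaType (M : LabeledRel L) (N : ℕ) : ∀ k, (ℕ → Option M.carrier) → HintikkaType L N k
  | 0, s => M.atomType N s
  | k + 1, s => (M.atomType N s, fun v =>
      Set.range fun a => M.hintikkaType N k (Function.update s v (some a)))

variable {M M' : LabeledRel L} {N k : ℕ} {s : ℕ → Option M.carrier} {s' : ℕ → Option M'.carrier}

/-- The back-and-forth condition of the Ehrenfeucht–Fraïssé game, in which a move reassigns one of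
the variables below `N`. -/
theorem hintikkaType_succ_eq_iff :
    M.hintikkaType N (k + 1) s = M'.hintikkaType N (k + 1) s' ↔
      M.atomType N s = M'.atomType N s' ∧ ∀ v < N,
        (∀ a, ∃ a', M.hintikkaType N k (Function.update s v (some a)) =
          M'.hintikkaType N k (Function.update s' v (some a'))) ∧
        ∀ a', ∃ a, M.hintikkaType N k (Function.update s v (some a)) =
          M'.hintikkaType N k (Function.update s' v (some a')) := by
  refine Prod.ext_iff.trans (and_congr Iff.rfl ?_)
  refine funext_iff.trans ⟨fun h v hv => ?_, fun h v => ?_⟩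
  · have h : Set.range _ = Set.range _ := h ⟨v, hv⟩
    refine ⟨fun a => ?_, fun a' => ?_⟩
    · obtain ⟨a', e⟩ := h ▸ Set.mem_range_self a
      exact ⟨a', e.symm⟩
    · obtain ⟨a, e⟩ := h.symm ▸ Set.mem_range_self a'
      exact ⟨a, e⟩
  · obtain ⟨h1, h2⟩ := h v v.2
    refine Set.Subset.antisymm ?_ ?_
    · rintro _ ⟨a, rfl⟩
      obtain ⟨a', e⟩ := h1 a
      exact ⟨a', e.symm⟩
    · rintro _ ⟨a', rfl⟩
      obtain ⟨a, e⟩ := h2 a'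
      exact ⟨a, e⟩

theorem atomType_eq_of_hintikkaType (h : M.hintikkaType N k s = M'.hintikkaType N k s') :
    M.atomType N s = M'.atomType N s' := by
  cases k with
  | zero => exact h
  | succ k => exact congrArg Prod.fst h

theorem atomType_eq_iff : M.atomType N s = M'.atomType N s' ↔
    (∀ v < N, (s v).map M.lab = (s' v).map M'.lab) ∧
    (∀ v < N, ∀ w < N, (∃ a, s v = some a ∧ s w = some a) ↔ ∃ a, s' v = some a ∧ s' w = some a) ∧
    ∀ v < N, ∀ w < N, (∃ a b, s v = some a ∧ s w = some b ∧ M.lt a b) ↔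
      ∃ a b, s' v = some a ∧ s' w = some b ∧ M'.lt a b := by
  simp only [atomType, Prod.mk.injEq, funext_iff, eq_iff_iff, Fin.forall_iff]

/-- The truth value of a formula is determined by the types of the assignment. -/
theorem exists_hintikkaType_determines {P : Type v} {O : Set BinRel} (pr : P → L → Prop)
    (φ : FO ℕ P O) : ∃ N₀ k₀, ∀ N ≥ N₀, ∀ k ≥ k₀, ∀ (M M' : LabeledRel L)
      (s : ℕ → Option M.carrier) (s' : ℕ → Option M'.carrier),
      M.hintikkaType N k s = M'.hintikkaType N k s' → (M.Sat pr φ s ↔ M'.Sat pr φ s') := by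
  induction φ with
  | eq x y =>
    refine ⟨x + y + 1, 0, fun N hN k _ M M' s s' h => ?_⟩
    exact (atomType_eq_iff.1 (atomType_eq_of_hintikkaType h)).2.1 x (by omega) y (by omega)
  | pred p x =>
    refine ⟨x + 1, 0, fun N hN k _ M M' s s' h => ?_⟩
    have := (atomType_eq_iff.1 (atomType_eq_of_hintikkaType h)).1 x (by omega)
    have e : ∀ (M : LabeledRel L) (s : ℕ → Option M.carrier),
        M.Sat pr (.pred p x : FO ℕ P O) s ↔ ∃ l, (s x).map M.lab = some l ∧ pr p l := by
      intro M s
      simp [Sat]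
    rw [e, e, this]
  | rel R hR x y =>
    -- The relation `≺_suc` hides a quantifier over intermediate values. It needs one round of the
    -- game and a spare variable, for which `x + y + 1` serves.
    refine ⟨x + y + 2, 1, fun N hN k hk M M' s s' h => ?_⟩
    obtain ⟨k, rfl⟩ : ∃ l, k = l + 1 := ⟨k - 1, by omega⟩
    rw [hintikkaType_succ_eq_iff, atomType_eq_iff] at h
    obtain ⟨⟨hl, -, hlt⟩, hz⟩ := h
    have hl' : ∀ v < N, s v = none ↔ s' v = none := fun v hv => by
      rw [← Option.map_eq_none_iff, hl v hv, Option.map_eq_none_iff]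
    have hz := hz (x + y + 1) (by omega)
    have hxN : x < N := by omega
    have hyN : y < N := by omega
    rcases hx : s x with _ | a
    · have := (hl' x hxN).1 hx
      simp [Sat, hx, this]
    rcases hx' : s' x with _ | a'
    · rw [(hl' x hxN).2 hx'] at hx
      cases hx
    rcases hy : s y with _ | b
    · have := (hl' y hyN).1 hy
      simp [Sat, hy, this]
    rcases hy' : s' y with _ | b'
    · rw [(hl' y hyN).2 hy'] at hy
      cases hy
    have key : M.Holds R a b ↔ M'.Holds R a' b' := by
      have h1 : M.lt a b ↔ M'.lt a' b' := by simpa [hx, hx', hy, hy'] using hlt x hxN y hyN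
      have h2 : M.lt b a ↔ M'.lt b' a' := by simpa [hx, hx', hy, hy'] using hlt y hyN x hxN
      cases R with
      | child => exact Iff.rfl
      | nextSibling => exact Iff.rfl
      | dataEq => exact and_congr (not_congr h1) (not_congr h2)
      | dataLt => exact h1
      | dataSuc =>
        have hc : ∀ c c', M.hintikkaType N k (Function.update s (x + y + 1) (some c)) =
            M'.hintikkaType N k (Function.update s' (x + y + 1) (some c')) →
            (M.lt a c ∧ M.lt c b ↔ M'.lt a' c' ∧ M'.lt c' b') := by
          intro c c' h
          have h := (atomType_eq_iff.1 (atomType_eq_of_hintikkaType h)).2.2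
          have e1 : x ≠ x + y + 1 := by omega
          have e2 : y ≠ x + y + 1 := by omega
          have h3 := h x hxN (x + y + 1) (by omega)
          have h4 := h (x + y + 1) (by omega) y hyN
          simp [e1, hx, hx'] at h3
          simp [e2, hy, hy'] at h4
          rw [h3, h4]
        refine and_congr h1 ⟨fun H c' => ?_, fun H c => ?_⟩
        · obtain ⟨c, e⟩ := hz.2 c'
          rw [← hc c c' e]
          exact H c
        · obtain ⟨c', e⟩ := hz.1 c
          rw [hc c c' e]
          exact H c'
    simpa [Sat, hx, hx', hy, hy'] using key
  | neg φ ih =>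
    obtain ⟨N₀, k₀, h⟩ := ih
    exact ⟨N₀, k₀, fun N hN k hk M M' s s' e => not_congr (h N hN k hk M M' s s' e)⟩
  | conj φ ψ ih1 ih2 =>
    obtain ⟨N₁, k₁, h1⟩ := ih1
    obtain ⟨N₂, k₂, h2⟩ := ih2
    exact ⟨N₁ + N₂, k₁ + k₂, fun N hN k hk M M' s s' e =>
      and_congr (h1 N (by omega) k (by omega) M M' s s' e)
        (h2 N (by omega) k (by omega) M M' s s' e)⟩
  | disj φ ψ ih1 ih2 =>
    obtain ⟨N₁, k₁, h1⟩ := ih1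
    obtain ⟨N₂, k₂, h2⟩ := ih2
    exact ⟨N₁ + N₂, k₁ + k₂, fun N hN k hk M M' s s' e =>
      or_congr (h1 N (by omega) k (by omega) M M' s s' e)
        (h2 N (by omega) k (by omega) M M' s s' e)⟩
  | all x φ ih =>
    obtain ⟨N₀, k₀, h⟩ := ih
    refine ⟨N₀ + x + 1, k₀ + 1, fun N hN k hk M M' s s' e => ?_⟩
    obtain ⟨k, rfl⟩ : ∃ l, k = l + 1 := ⟨k - 1, by omega⟩
    rw [hintikkaType_succ_eq_iff] at e
    obtain ⟨h1, h2⟩ := e.2 x (by omega)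
    refine ⟨fun H a' => ?_, fun H a => ?_⟩
    · obtain ⟨a, e⟩ := h2 a'
      exact (h N (by omega) k (by omega) M M' _ _ e).1 (H a)
    · obtain ⟨a', e⟩ := h1 a
      exact (h N (by omega) k (by omega) M M' _ _ e).2 (H a')
  | ex x φ ih =>
    obtain ⟨N₀, k₀, h⟩ := ih
    refine ⟨N₀ + x + 1, k₀ + 1, fun N hN k hk M M' s s' e => ?_⟩
    obtain ⟨k, rfl⟩ : ∃ l, k = l + 1 := ⟨k - 1, by omega⟩
    rw [hintikkaType_succ_eq_iff] at e
    obtain ⟨h1, h2⟩ := e.2 x (by omega)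
    refine ⟨fun ⟨a, H⟩ => ?_, fun ⟨a', H⟩ => ?_⟩
    · obtain ⟨a', e⟩ := h1 a
      exact ⟨a', (h N (by omega) k (by omega) M M' _ _ e).1 H⟩
    · obtain ⟨a, e⟩ := h2 a'
      exact ⟨a, (h N (by omega) k (by omega) M M' _ _ e).2 H⟩

end LabeledRel

/-! ### Types of ordered sums and counting up to a threshold -/

namespace LabeledRel
variable {L : Type} {M M' : LabeledRel L} {N k : ℕ}

theorem atomType_update_none {s : ℕ → Option M.carrier} {s' : ℕ → Option M'.carrier}
    (h : M.atomType N s = M'.atomType N s') (v : ℕ) :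
    M.atomType N (Function.update s v none) = M'.atomType N (Function.update s' v none) := by
  rw [atomType_eq_iff] at h ⊢
  obtain ⟨h1, h2, h3⟩ := h
  refine ⟨fun x hx => ?_, fun x hx y hy => ?_, fun x hx y hy => ?_⟩
  · by_cases e : x = v
    · simp [e]
    · simpa [e] using h1 x hx
  · by_cases e : x = v
    · simp [e]
    · by_cases e' : y = v
      · simp [e']
      · simpa [e, e'] using h2 x hx y hy
  · by_cases e : x = v
    · simp [e]
    · by_cases e' : y = v
      · simp [e']
      · simpa [e, e'] using h3 x hx y hy

/-- Used when a variable moves into the other summand of an ordered sum and so loses its value in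
this one. -/
theorem hintikkaType_update_none {s : ℕ → Option M.carrier} {s' : ℕ → Option M'.carrier}
    (h : M.hintikkaType N k s = M'.hintikkaType N k s') (v : ℕ) :
    M.hintikkaType N k (Function.update s v none) =
      M'.hintikkaType N k (Function.update s' v none) := by
  induction k generalizing s s' with
  | zero => exact atomType_update_none h v
  | succ k ih =>
    rw [hintikkaType_succ_eq_iff] at h ⊢
    refine ⟨atomType_update_none h.1 v, fun w hw => ?_⟩
    obtain ⟨h1, h2⟩ := h.2 w hw
    by_cases e : w = v
    · subst e
      simpa only [Function.update_idem] using h.2 w hw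
    · simp only [Function.update_comm (Ne.symm e)]
      refine ⟨fun a => ?_, fun a' => ?_⟩
      · obtain ⟨a', h⟩ := h1 a
        exact ⟨a', ih h⟩
      · obtain ⟨a, h⟩ := h2 a'
        exact ⟨a, ih h⟩

theorem hintikkaType_of_succ {s : ℕ → Option M.carrier} {s' : ℕ → Option M'.carrier}
    (h : M.hintikkaType N (k + 1) s = M'.hintikkaType N (k + 1) s') :
    M.hintikkaType N k s = M'.hintikkaType N k s' := by
  induction k generalizing s s' with
  | zero => exact (hintikkaType_succ_eq_iff.1 h).1
  | succ k ih =>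
    rw [hintikkaType_succ_eq_iff] at h ⊢
    exact ⟨h.1, fun v hv => ⟨fun a => ((h.2 v hv).1 a).imp fun _ => ih,
      fun a' => ((h.2 v hv).2 a').imp fun _ => ih⟩⟩

/-- The ordered sum. -/
abbrev sum (M K : LabeledRel L) : LabeledRel L where
  carrier := M.carrier ⊕ K.carrier
  lab := Sum.elim M.lab K.lab
  lt
    | .inl a, .inl b => M.lt a b
    | .inl _, .inr _ => True
    | .inr _, .inl _ => False
    | .inr a, .inr b => K.lt a b

/-- The assignment in an ordered sum given by assignments in the summands. -/
def sumAssign {α β : Type} (s : ℕ → Option α) (r : ℕ → Option β) (v : ℕ) : Option (α ⊕ β) :=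
  match s v with
  | some a => some (.inl a)
  | none => (r v).map .inr

theorem update_sumAssign_inl {α β : Type} (s : ℕ → Option α) (r : ℕ → Option β) (v : ℕ) (a : α) :
    Function.update (sumAssign s r) v (some (.inl a)) =
      sumAssign (Function.update s v (some a)) r := by
  funext w
  by_cases e : w = v
  · subst e; simp [sumAssign]
  · simp [sumAssign, e]

theorem update_sumAssign_inr {α β : Type} (s : ℕ → Option α) (r : ℕ → Option β) (v : ℕ) (b : β) :
    Function.update (sumAssign s r) v (some (.inr b)) =
      sumAssign (Function.update s v none) (Function.update r v (some b)) := by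
  funext w
  by_cases e : w = v
  · subst e; simp [sumAssign]
  · simp [sumAssign, e]

theorem atomType_sum (K : LabeledRel L) {s : ℕ → Option M.carrier} {s' : ℕ → Option M'.carrier}
    (r : ℕ → Option K.carrier) (h : M.atomType N s = M'.atomType N s') :
    (M.sum K).atomType N (sumAssign s r) = (M'.sum K).atomType N (sumAssign s' r) := by
  rw [atomType_eq_iff] at h ⊢
  obtain ⟨h1, h2, h3⟩ := h
  have key : ∀ v < N, (s v = none ∧ s' v = none) ∨ ∃ a a', s v = some a ∧ s' v = some a' := by
    intro v hv
    have := h1 v hv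
    rcases e : s v with _ | a <;> rcases e' : s' v with _ | a' <;> simp [e, e'] at this ⊢
  refine ⟨fun x hx => ?_, fun x hx y hy => ?_, fun x hx y hy => ?_⟩
  · have := h1 x hx
    rcases key x hx with ⟨e, e'⟩ | ⟨a, a', e, e'⟩
    · cases hr : r x <;> simp [sumAssign, e, e', hr, sum]
    · simpa [sumAssign, e, e', sum] using this
  · have := h2 x hx y hy
    rcases key x hx with ⟨e, e'⟩ | ⟨a, a', e, e'⟩ <;>
    rcases key y hy with ⟨f, f'⟩ | ⟨b, b', f, f'⟩ <;>
    simp [sumAssign, e, e', f, f', sum] at this ⊢; assumption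
  · have := h3 x hx y hy
    rcases key x hx with ⟨e, e'⟩ | ⟨a, a', e, e'⟩ <;>
    rcases key y hy with ⟨f, f'⟩ | ⟨b, b', f, f'⟩ <;>
    simp [sumAssign, e, e', f, f', sum] at this ⊢; assumption

/-- The strategies combine: a move in the left summand is answered by the given back-and-forth
condition, a move in the common summand `K` by the same element. -/
theorem hintikkaType_sum (K : LabeledRel L) {s : ℕ → Option M.carrier}
    {s' : ℕ → Option M'.carrier} (r : ℕ → Option K.carrier)
    (h : M.hintikkaType N k s = M'.hintikkaType N k s') :
    (M.sum K).hintikkaType N k (sumAssign s r) =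
      (M'.sum K).hintikkaType N k (sumAssign s' r) := by
  induction k generalizing s s' r with
  | zero => exact atomType_sum K r h
  | succ k ih =>
    have h0 := hintikkaType_succ_eq_iff.1 h
    refine hintikkaType_succ_eq_iff.2 ⟨atomType_sum K r h0.1, fun v hv => ?_⟩
    obtain ⟨h1, h2⟩ := h0.2 v hv
    have hk : M.hintikkaType N k (Function.update s v none) =
        M'.hintikkaType N k (Function.update s' v none) :=
      hintikkaType_update_none (hintikkaType_of_succ h) v
    refine ⟨?_, ?_⟩
    · rintro (a | b)
      · obtain ⟨a', e⟩ := h1 a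
        refine ⟨.inl a', ?_⟩
        rw [update_sumAssign_inl, update_sumAssign_inl]
        exact ih r e
      · refine ⟨.inr b, ?_⟩
        rw [update_sumAssign_inr, update_sumAssign_inr]
        exact ih _ hk
    · rintro (a' | b)
      · obtain ⟨a, e⟩ := h2 a'
        refine ⟨.inl a, ?_⟩
        rw [update_sumAssign_inl, update_sumAssign_inl]
        exact ih r e
      · refine ⟨.inr b, ?_⟩
        rw [update_sumAssign_inr, update_sumAssign_inr]
        exact ih _ hk

theorem hintikkaType_equiv (e : M.carrier ≃ M'.carrier) (hl : ∀ a, M'.lab (e a) = M.lab a)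
    (hlt : ∀ a b, M'.lt (e a) (e b) ↔ M.lt a b) (s : ℕ → Option M.carrier) :
    M.hintikkaType N k s = M'.hintikkaType N k (fun v => (s v).map e) := by
  have h0 : ∀ s : ℕ → Option M.carrier,
      M.atomType N s = M'.atomType N (fun v => (s v).map e) := by
    intro s
    refine atomType_eq_iff.2 ⟨fun v _ => ?_, fun v _ w _ => ?_, fun v _ w _ => ?_⟩
    · simp [Function.comp_def, hl]
    · rcases s v <;> rcases s w <;> simp
    · rcases s v <;> rcases s w <;> simp [hlt]
  have hu : ∀ (s : ℕ → Option M.carrier) v a, (fun w => (Function.update s v (some a) w).map e) =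
      Function.update (fun w => (s w).map e) v (some (e a)) := by
    intro s v a
    funext w
    by_cases h : w = v
    · subst h; simp
    · simp [h]
  induction k generalizing s with
  | zero => exact h0 s
  | succ k ih =>
    refine hintikkaType_succ_eq_iff.2 ⟨h0 s, fun v _ => ⟨fun a => ⟨e a, ?_⟩, fun a' =>
      ⟨e.symm a', ?_⟩⟩⟩
    · rw [ih, hu]
    · rw [ih, hu, e.apply_symm_apply]

/-- Assignments to the variables below `N` that agree on colours and on equalities. -/
def AssignEquiv {α β C : Type} (c : α → C) (c' : β → C) (N : ℕ) (s : ℕ → Option α)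
    (s' : ℕ → Option β) : Prop :=
  (∀ v < N, (s v).map c = (s' v).map c') ∧ ∀ v < N, ∀ w < N, s v = s w ↔ s' v = s' w

theorem AssignEquiv.symm {α β C : Type} {c : α → C} {c' : β → C} {s : ℕ → Option α}
    {s' : ℕ → Option β} (h : AssignEquiv c c' N s s') : AssignEquiv c' c N s' s :=
  ⟨fun v hv => (h.1 v hv).symm, fun v hv w hw => (h.2 v hv w hw).symm⟩

/-- If `a` is already the value of another variable, the answer is forced. Otherwise an element of
the same colour not held by another variable is needed, and the counts in `hc` provide one. -/
theorem AssignEquiv.extend {α β C : Type} [Finite α] [Finite β] {c : α → C} {c' : β → C}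
    (hc : ∀ d, {a | c a = d}.ncard = {b | c' b = d}.ncard ∨ N ≤ {b | c' b = d}.ncard)
    {s : ℕ → Option α} {s' : ℕ → Option β} (h : AssignEquiv c c' N s s') {v : ℕ} (hv : v < N)
    (a : α) : ∃ b, AssignEquiv c c' N (Function.update s v (some a))
      (Function.update s' v (some b)) := by
  obtain ⟨h1, h2⟩ := h
  have key : ∃ b, c' b = c a ∧ ∀ w < N, w ≠ v → (s w = some a ↔ s' w = some b) := by
    by_cases hex : ∃ w < N, w ≠ v ∧ s w = some a
    · obtain ⟨w, hw, -, e⟩ := hex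
      have := h1 w hw
      rw [e] at this
      obtain ⟨b, e', hb⟩ := Option.map_eq_some_iff.1 this.symm
      exact ⟨b, hb, fun w' hw' _ => by rw [← e, ← e', h2 w' hw' w hw]⟩
    · push Not at hex
      suffices ∃ b, c' b = c a ∧ ∀ w < N, w ≠ v → s' w ≠ some b by
        obtain ⟨b, hb, hb'⟩ := this
        exact ⟨b, hb, fun w hw hne => ⟨fun e => absurd e (hex w hw hne),
          fun e => absurd e (hb' w hw hne)⟩⟩
      by_contra! hall
      have hex' : ∀ b : {b | c' b = c a}, ∃ w < N, w ≠ v ∧ s' w = some b.1 := fun b => hall b.1 b.2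
      choose f hfN hfv hf using hex'
      -- If every element of the colour were held by a variable other than `v`, there would be fewer
      -- than `N` of them, so the two colour classes would have equal size.
      have hlt : {b | c' b = c a}.ncard < N := by
        have hinj : Function.Injective fun b => (⟨f b, hfN b⟩ : Fin N) := by
          intro b b' e
          have e : f b = f b' := congrArg Fin.val e
          have := hf b
          rw [e, hf b'] at this
          exact Subtype.ext (Option.some.inj this).symm
        rw [← Nat.card_coe_set_eq]
        have hsub : Set.range (fun b => (⟨f b, hfN b⟩ : Fin N)) ⊂ Set.univ := by
          refine Set.ssubset_univ_iff.2 fun e => ?_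
          obtain ⟨b, hb⟩ := Set.range_eq_univ.1 e ⟨v, hv⟩
          exact hfv b (congrArg Fin.val hb)
        have := Set.ncard_lt_ncard hsub
        rw [Set.ncard_univ, Nat.card_fin, ← Nat.card_coe_set_eq,
          Nat.card_range_of_injective hinj] at this
        exact this
      have heq := (hc (c a)).resolve_right (by omega)
      have hg : ∀ b : {b | c' b = c a}, ∃ a', s (f b) = some a' ∧ c a' = c a := by
        intro b
        have := h1 (f b) (hfN b)
        rw [hf b, Option.map_some] at this
        obtain ⟨a', e, e'⟩ := Option.map_eq_some_iff.1 this
        exact ⟨a', e, e'.trans b.2⟩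
      choose g hg1 hg2 using hg
      have hinj : Function.Injective g := by
        intro b b' e
        have e2 : s (f b) = s (f b') := by rw [hg1, hg1, e]
        have := (h2 _ (hfN b) _ (hfN b')).1 e2
        rw [hf, hf] at this
        exact Subtype.ext (Option.some.inj this)
      -- The same variables would then hold equally many elements of the class of `a`, none of them
      -- `a`, which contradicts equal size.
      have hsub : Set.range g ⊂ {a' | c a' = c a} := by
        refine (Set.ssubset_iff_of_subset ?_).2 ⟨a, rfl, ?_⟩
        · rintro _ ⟨b, rfl⟩
          exact hg2 b
        · rintro ⟨b, e⟩
          exact hex (f b) (hfN b) (hfv b) (by rw [hg1 b, e])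
      have := Set.ncard_lt_ncard hsub
      rw [heq, ← Nat.card_coe_set_eq, Nat.card_range_of_injective hinj,
        Nat.card_coe_set_eq] at this
      exact lt_irrefl _ this
  obtain ⟨b, hb, hb'⟩ := key
  refine ⟨b, fun w hw => ?_, fun w hw w' hw' => ?_⟩
  · by_cases e : w = v
    · subst e; simp [hb]
    · simpa [e] using h1 w hw
  · by_cases e : w = v
    · by_cases e' : w' = v
      · rw [e, e']; simp
      · subst e
        simpa [e', eq_comm] using hb' w' hw' e'
    · by_cases e' : w' = v
      · subst e'
        simpa [e] using hb' w hw e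
      · simpa [e, e'] using h2 w hw w' hw'

/-- Structures whose relations are given by colours that occur equally often, or at least `N`
times, have the same types. -/
theorem hintikkaType_eq_of_colors {C : Type} [Finite M.carrier] [Finite M'.carrier]
    (c : M.carrier → C) (c' : M'.carrier → C) (ℓ : C → L) (r : C → C → Prop)
    (hl : ∀ a, M.lab a = ℓ (c a)) (hl' : ∀ a, M'.lab a = ℓ (c' a))
    (hr : ∀ a b, M.lt a b ↔ r (c a) (c b)) (hr' : ∀ a b, M'.lt a b ↔ r (c' a) (c' b))
    (hc : ∀ d, {a | c a = d}.ncard = {b | c' b = d}.ncard ∨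
      (N ≤ {a | c a = d}.ncard ∧ N ≤ {b | c' b = d}.ncard))
    {s : ℕ → Option M.carrier} {s' : ℕ → Option M'.carrier} (h : AssignEquiv c c' N s s') :
    M.hintikkaType N k s = M'.hintikkaType N k s' := by
  have h0 : ∀ {s : ℕ → Option M.carrier} {s' : ℕ → Option M'.carrier},
      AssignEquiv c c' N s s' → M.atomType N s = M'.atomType N s' := by
    rintro s s' ⟨h1, h2⟩
    refine atomType_eq_iff.2 ⟨fun v hv => ?_, fun v hv w hw => ?_, fun v hv w hw => ?_⟩
    · have := congrArg (Option.map ℓ) (h1 v hv)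
      rw [Option.map_map, Option.map_map] at this
      rwa [show M.lab = ℓ ∘ c from funext hl, show M'.lab = ℓ ∘ c' from funext hl']
    · have := h2 v hv w hw
      have hv' := h1 v hv
      have hw' := h1 w hw
      rcases e1 : s v with _ | a <;> rcases e2 : s' v with _ | a' <;>
      rcases e3 : s w with _ | b <;> rcases e4 : s' w with _ | b' <;>
      simp_all [eq_comm]
    · have hv' := h1 v hv
      have hw' := h1 w hw
      rcases e1 : s v with _ | a <;> rcases e2 : s' v with _ | a' <;>
      rcases e3 : s w with _ | b <;> rcases e4 : s' w with _ | b' <;>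
      simp_all
  induction k generalizing s s' with
  | zero => exact h0 h
  | succ k ih =>
    refine hintikkaType_succ_eq_iff.2 ⟨h0 h, fun v hv => ⟨fun a => ?_, fun a' => ?_⟩⟩
    · obtain ⟨b, hb⟩ := h.extend (fun d => (hc d).imp id And.right) hv a
      exact ⟨b, ih hb⟩
    · obtain ⟨b, hb⟩ := h.symm.extend (fun d => (hc d).imp Eq.symm And.left) hv a'
      exact ⟨b, ih hb.symm⟩

end LabeledRel

/-! ### Words of sets as labelled orders -/

namespace LabeledRel
variable {L : Type} {N k : ℕ}

/-- The structure given by a word of sets of letters, where the letters carry labels. -/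
def ofWord {G : Type} (ℓ : G → L) (w : List (Set G)) : LabeledRel L where
  carrier := {p : ℕ × G // ∃ S, w[p.1]? = some S ∧ p.2 ∈ S}
  lab p := ℓ p.1.2
  lt p q := p.1.1 < q.1.1

theorem ofWord_append {G : Type} (ℓ : G → L) (x y : List (Set G)) :
    ((ofWord ℓ x).sum (ofWord ℓ y)).hintikkaType N k (fun _ => none) =
      (ofWord ℓ (x ++ y)).hintikkaType N k (fun _ => none) := by
  have hx : ∀ p : (ofWord ℓ x).carrier, p.1.1 < x.length := fun p => by
    obtain ⟨S, h, -⟩ := p.2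
    exact (List.getElem?_eq_some_iff.1 h).1
  let f : (ofWord ℓ x).carrier ⊕ (ofWord ℓ y).carrier → (ofWord ℓ (x ++ y)).carrier :=
    Sum.elim (fun p => ⟨p.1, by
      obtain ⟨S, h, h'⟩ := p.2
      exact ⟨S, by rw [List.getElem?_append_left (hx p), h], h'⟩⟩)
      (fun p => ⟨(x.length + p.1.1, p.1.2), by
      obtain ⟨S, h, h'⟩ := p.2
      refine ⟨S, ?_, h'⟩
      rw [List.getElem?_append_right (by simp)]
      simpa using h⟩)
  have hl : ∀ p, (f (.inl p)).1 = p.1 := fun _ => rfl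
  have hr : ∀ p, (f (.inr p)).1 = (x.length + p.1.1, p.1.2) := fun _ => rfl
  have hf : Function.Bijective f := by
    constructor
    · rintro (p | p) (q | q) e
      · have : (f (.inl p)).1 = (f (.inl q)).1 := congrArg Subtype.val e
        exact congrArg Sum.inl (Subtype.ext this)
      · have := congrArg (fun z => z.1.1) e
        simp only [hl, hr] at this
        have := hx p
        omega
      · have := congrArg (fun z => z.1.1) e
        simp only [hl, hr] at this
        have := hx q
        omega
      · have := congrArg Subtype.val e
        simp only [hr, Prod.mk.injEq, add_right_inj] at this
        exact congrArg Sum.inr (Subtype.ext (Prod.ext this.1 this.2))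
    · rintro ⟨⟨i, g⟩, S, h, hg⟩
      by_cases hi : i < x.length
      · exact ⟨.inl ⟨(i, g), S, by rwa [List.getElem?_append_left hi] at h, hg⟩, rfl⟩
      · rw [List.getElem?_append_right (by simpa using hi)] at h
        refine ⟨.inr ⟨(i - x.length, g), S, h, hg⟩, Subtype.ext (Prod.ext ?_ rfl)⟩
        change x.length + (i - x.length) = i
        omega
  refine (hintikkaType_equiv (Equiv.ofBijective f hf) ?_ ?_ _)
  · rintro (p | p) <;> rfl
  · rintro (p | p) (q | q)
    · exact Iff.rfl
    · exact ⟨fun _ => trivial, fun _ => Nat.lt_of_lt_of_le (hx p) (Nat.le_add_right _ _)⟩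
    · exact ⟨fun h => absurd (Nat.lt_of_lt_of_le (hx q) (Nat.le_add_right _ _)) (Nat.lt_asymm h),
        False.elim⟩
    · exact Nat.add_lt_add_iff_left

/-- Concatenation of words is an ordered sum, so the type of `x ++ y` depends on `x` only through
its type, which takes finitely many values. -/
theorem isRegular_hintikkaType {G : Type} [Finite L] (ℓ : G → L)
    (valid : Set G → Prop) (H : Set (HintikkaType L N k)) :
    Language.IsRegular ({w | (∀ S ∈ w, valid S) ∧
      (ofWord ℓ w).hintikkaType N k (fun _ => none) ∈ H} : Set (List (Set G))) := by
  refine isRegular_of_finite_invariant (τ := Prop × HintikkaType L N k)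
    (fun w => (∀ S ∈ w, valid S, (ofWord ℓ w).hintikkaType N k (fun _ => none))) ?_
  intro x x' h y ⟨h1, h2⟩
  simp only [Prod.mk.injEq, eq_iff_iff] at h
  refine ⟨fun S hS => ?_, ?_⟩
  · rcases List.mem_append.1 hS with hS | hS
    · exact h.1.1 (fun S hS => h1 S (List.mem_append_left _ hS)) S hS
    · exact h1 S (List.mem_append_right _ hS)
  · have := hintikkaType_sum (ofWord ℓ y) (fun _ => none) h.2
    change LabeledRel.hintikkaType _ N k (fun _ => none) =
      LabeledRel.hintikkaType _ N k (fun _ => none) at this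
    rw [ofWord_append, ofWord_append] at this
    exact this ▸ h2

end LabeledRel

/-! ### Counting nodes up to a threshold by means of keys -/

section Numbering
variable {L : Type} {A : Type u} {N : ℕ}

/-- A set of labels numbered `0, …, N` that contains all the copies of a label if it contains the
last one. -/
def IsSaturated (S : Set (L × Fin (N + 1))) : Prop :=
  ∀ l, (l, Fin.last N) ∈ S → ∀ j, (l, j) ∈ S

/-- A numbering of the labels of `t` such that nodes with the same label and data value have
different numbers, unless the number is `N`. -/
def IsKeyed (t : DataTree A) (g : t.dom.Node → L × Fin (N + 1)) : Prop :=
  ∀ u v, u ≠ v → g u = g v → (g u).2 ≠ Fin.last N → t.val u ≠ t.val v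

theorem exists_numbering (t : DataTree A) (x : t.dom.Node → L) (N : ℕ) :
    ∃ g : t.dom.Node → L × Fin (N + 1), (∀ u, (g u).1 = x u) ∧ IsKeyed t g ∧
      ∀ d, IsSaturated ((t.relabel g).labelsAt d) := by
  have hfin : ∀ c : ℕ × L, ∃ n, Nonempty ({u // (t.val u, x u) = c} ≃ Fin n) := fun c =>
    Finite.exists_equiv_fin _
  choose n e using hfin
  let idx : t.dom.Node → ℕ := fun u => ((e (t.val u, x u)).some ⟨u, rfl⟩ : Fin _)
  have hidx : ∀ c (u) (hu : (t.val u, x u) = c), idx u = ((e c).some ⟨u, hu⟩ : Fin _) := by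
    rintro _ u rfl; rfl
  -- The nodes with a given data value and label are enumerated, and the index is capped at `N`. An
  -- index of at least `N` forces more than `N` such nodes, hence all smaller numbers occur.
  refine ⟨fun u => (x u, ⟨min (idx u) N, by omega⟩), fun u => rfl, ?_, ?_⟩
  · intro u v huv h1 h2 hval
    simp only [Prod.mk.injEq, Fin.mk.injEq] at h1
    simp only [ne_eq, Fin.ext_iff, Fin.val_last] at h2
    have hi : idx u = idx v := by omega
    have hc : (t.val v, x v) = (t.val u, x u) := by rw [hval, h1.1]
    rw [hidx _ u rfl, hidx _ v hc] at hi
    have := (e _).some.injective (Fin.ext hi)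
    exact huv (congrArg Subtype.val this)
  · rintro d l ⟨u, hu, hd⟩ j
    obtain ⟨rfl, hu'⟩ := Prod.mk.inj hu
    have hN : N ≤ idx u := by
      have := congrArg Fin.val hu'
      simp only [Fin.val_last] at this
      omega
    have hlt : idx u < n (t.val u, x u) := ((e (t.val u, x u)).some ⟨u, rfl⟩).2
    let v := (e (t.val u, x u)).some.symm ⟨j, by omega⟩
    have hv : idx v.1 = j := by
      rw [hidx _ v.1 v.2]
      simp [v]
    obtain ⟨h1, h2⟩ := Prod.mk.inj v.2
    refine ⟨v.1, Prod.ext h2 (Fin.ext ?_), h1.trans hd⟩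
    change min (idx v.1) N = j
    omega

/-- The word forgets only how often number `N` is repeated at a value, and this lies beyond the
threshold. The colours compared are pairs of a data value and a label. -/
theorem hintikkaType_ofTree (t : DataTree A) (x : t.dom.Node → L) (k : ℕ)
    (g : t.dom.Node → L × Fin (N + 1)) (hx : ∀ u, (g u).1 = x u) (hk : IsKeyed t g)
    (hs : ∀ d, IsSaturated ((t.relabel g).labelsAt d)) :
    (LabeledRel.ofTree t x).hintikkaType N k (fun _ => none) =
      (LabeledRel.ofWord Prod.fst (t.relabel g).stringRep).hintikkaType N k (fun _ => none) := by
  set V := t.values.sort (· ≤ ·) with hV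
  have hmono : V.SortedLT := Finset.sortedLT_sort _
  have hmem : ∀ u, t.val u ∈ V := fun u => by
    rw [hV, Finset.mem_sort]
    exact Finset.mem_image_of_mem _ (Finset.mem_univ u)
  have hrep : (t.relabel g).stringRep = V.map (t.relabel g).labelsAt := rfl
  let W := (LabeledRel.ofWord Prod.fst (t.relabel g).stringRep).carrier
  have hW : ∀ p : W, ∃ d, V[p.1.1]? = some d ∧ ∃ u, g u = p.1.2 ∧ t.val u = d := by
    rintro ⟨p, S, h, hp⟩
    rw [hrep, List.getElem?_map, Option.map_eq_some_iff] at h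
    obtain ⟨d, hd, rfl⟩ := h
    exact ⟨d, hd, hp⟩
  choose dv hdv hu using hW
  let F : t.dom.Node → W := fun u => ⟨(V.idxOf (t.val u), g u), (t.relabel g).labelsAt (t.val u), by
    rw [hrep, List.getElem?_map, List.getElem?_idxOf (hmem u)]; rfl, u, rfl, rfl⟩
  have hF1 : ∀ u, (F u).1.2 = g u := fun _ => rfl
  have hFd : ∀ u, dv (F u) = t.val u := fun u => by
    have h1 := hdv (F u)
    have h2 : V[(F u).1.1]? = some (t.val u) := List.getElem?_idxOf (hmem u)
    exact Option.some.inj (h1.symm.trans h2)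
  have hidx : ∀ p q : W, p.1.1 < q.1.1 ↔ dv p < dv q := fun p q => by
    obtain ⟨h1, e1⟩ := List.getElem?_eq_some_iff.1 (hdv p)
    obtain ⟨h2, e2⟩ := List.getElem?_eq_some_iff.1 (hdv q)
    rw [← e1, ← e2]
    exact (hmono.strictMono_get.lt_iff_lt (a := ⟨_, h1⟩) (b := ⟨_, h2⟩)).symm
  have hFsurj : Function.Surjective F := fun p => by
    obtain ⟨u, h1, h2⟩ := hu p
    refine ⟨u, Subtype.ext (Prod.ext ?_ h1)⟩
    have e := hFd u
    have a1 := hidx (F u) p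
    have a2 := hidx p (F u)
    omega
  have hWfin : Finite W := Finite.of_surjective F hFsurj
  have hTfin : Finite (LabeledRel.ofTree t x).carrier := inferInstanceAs (Finite t.dom.Node)
  refine LabeledRel.hintikkaType_eq_of_colors (C := ℕ × L)
    (M := LabeledRel.ofTree t x) (M' := LabeledRel.ofWord Prod.fst (t.relabel g).stringRep)
    (fun u => (t.val u, x u)) (fun p => (dv p, p.1.2.1)) Prod.snd
    (fun a b => a.1 < b.1) (fun _ => rfl) (fun _ => rfl) (fun _ _ => Iff.rfl) hidx ?_
    ⟨fun _ _ => rfl, fun _ _ _ _ => ⟨fun _ => rfl, fun _ => rfl⟩⟩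
  intro c
  have himg : {p : W | (dv p, p.1.2.1) = c} = F '' {u | (t.val u, x u) = c} := by
    ext p
    constructor
    · rintro rfl
      obtain ⟨u, rfl⟩ := hFsurj p
      refine ⟨u, ?_, rfl⟩
      change (t.val u, x u) = (dv (F u), (g u).1)
      rw [hFd, hx]
    · rintro ⟨u, rfl, rfl⟩
      change (dv (F u), (g u).1) = (t.val u, x u)
      rw [hFd, hx]
  -- Either no two nodes of the colour are merged and the counts agree, or merged nodes carry number
  -- `N` by `hk`, and saturation gives at least `N + 1` elements in the word and so as many nodes.
  by_cases hinj : Set.InjOn F {u | (t.val u, x u) = c}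
  · left
    refine Eq.trans ?_ (congrArg Set.ncard himg).symm
    exact hinj.ncard_image.symm
  · right
    have hge : N ≤ {p : W | (dv p, p.1.2.1) = c}.ncard := by
      unfold Set.InjOn at hinj
      push Not at hinj
      obtain ⟨u, rfl, v, hv, e, hne⟩ := hinj
      have hg : g u = g v := congrArg (fun p => p.1.2) e
      have hlast : (g u).2 = Fin.last N := by
        by_contra h
        exact hk u v hne hg h (congrArg Prod.fst hv).symm
      have hall : ∀ j, ∃ z, g z = (x u, j) ∧ t.val z = t.val u := by
        refine hs (t.val u) (x u) ⟨u, ?_, rfl⟩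
        exact Prod.ext (hx u) hlast
      choose z hz1 hz2 using hall
      have hzinj : Function.Injective fun j => F (z j) := fun i j h => by
        have : g (z i) = g (z j) := congrArg (fun p => p.1.2) h
        rw [hz1, hz1] at this
        exact (Prod.mk.inj this).2
      have hsub : Set.range (fun j => F (z j)) ⊆ {p : W | (dv p, p.1.2.1) = (t.val u, x u)} := by
        rintro _ ⟨j, rfl⟩
        change (dv (F (z j)), (g (z j)).1) = (t.val u, x u)
        rw [hFd, hz1, hz2]
      have := Set.ncard_le_ncard hsub
      rw [← Nat.card_coe_set_eq, Nat.card_range_of_injective hzinj, Nat.card_fin] at this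
      omega
    refine ⟨hge.trans ?_, hge⟩
    rw [himg]
    exact Set.ncard_image_le (Set.toFinite _)

end Numbering

/-! ### From formulas to automata -/

theorem FO.IsSentence.models_iff_ofTree {L : Type} {A : Type u} {P : Type v} (pr : P → L → Prop)
    {ψ : FO ℕ P {BinRel.dataEq, BinRel.dataLt, BinRel.dataSuc}} (hψ : ψ.IsSentence)
    (t : DataTree A) (x : t.dom.Node → L) :
    ψ.Models t (fun p => {u | pr p (x u)}) ↔
      (LabeledRel.ofTree t x).Sat pr ψ (fun _ => none) := by
  rw [hψ.models_iff fun _ => t.dom.root, ← LabeledRel.sat_ofTree]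
  refine LabeledRel.sat_congr _ pr ψ fun v hv => ?_
  rw [show ψ.freeVars = ∅ from hψ] at hv
  exact hv.elim

theorem exists_weakODTA_of_formula {A : Type u} [Finite A] {m : ℕ}
    (φ : FO2 A m {BinRel.child, BinRel.nextSibling})
    (ψ : FOω A m {BinRel.dataEq, BinRel.dataLt, BinRel.dataSuc})
    (hφ : φ.IsSentence) (hψ : ψ.IsSentence) :
    ∃ S : WeakODTA A, S.language = definedLanguage φ ψ := by
  obtain ⟨n, ⟨e⟩⟩ := Finite.exists_equiv_fin A
  -- Labels are replaced by `Fin n` because output alphabets live in `Type`, whereas `A` may lie in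
  -- any universe.
  let L := Fin n × (Fin m → Prop)
  let pr : A ⊕ Fin m → L → Prop := fun p l => Sum.elim (fun a => l.1 = e a) l.2 p
  obtain ⟨T, hT⟩ := hφ.exists_transducer A pr
  obtain ⟨N, k, hN⟩ := LabeledRel.exists_hintikkaType_determines pr ψ
  replace hN := hN N le_rfl k le_rfl
  -- The types realised by models of ψ. By `hN`, any structure whose type lies in `H` is itself a
  -- model.
  let H : Set (LabeledRel.HintikkaType L N k) := {h | ∃ M : LabeledRel L,
    M.hintikkaType N k (fun _ => none) = h ∧ M.Sat pr ψ (fun _ => none)}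
  obtain ⟨σ, hσ, M, hM⟩ := LabeledRel.isRegular_hintikkaType (G := L × Fin (N + 1)) Prod.fst
    IsSaturated H
  have hinterp : ∀ (t : DataTree A) (x : t.dom.Node → L), (∀ u, (x u).1 = e (t.lab u)) →
      unaryInterp t (fun i => {u | (x u).2 i}) = fun p => {u | pr p (x u)} := by
    intro t x hx
    funext p
    cases p with
    | inl a =>
      ext u
      change t.lab u = a ↔ (x u).1 = e a
      rw [hx, e.apply_eq_iff_eq]
    | inr i => rfl
  let S : WeakODTA A :=
    { Out := L × Fin (N + 1)
      finite_out := inferInstance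
      transducer := ((TreeTransducer.relabel fun a (l : L) => l.1 = e a).comp T).comp
        (TreeTransducer.relabel fun l (o : L × Fin (N + 1)) => o.1 = l)
      State := σ
      finite_state := inferInstance
      automaton := M.toNFA
      keys := {o | o.2 ≠ Fin.last N} }
  have hout : ∀ (t : DataTree A) (g : t.dom.Node → L × Fin (N + 1)),
      S.transducer.IsOutput t.proj g ↔ (∀ u, (g u).1.1 = e (t.lab u)) ∧
        φ.Models t (fun p => {u | pr p (g u).1}) := by
    intro t g
    refine (TreeTransducer.comp_isOutput _ _ _ _ _).trans ?_
    simp only [TreeTransducer.comp_isOutput, TreeTransducer.relabel_isOutput, hT]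
    constructor
    · rintro ⟨x, ⟨_, h1, rfl, h2⟩, h3⟩
      obtain rfl : (fun u => (g u).1) = x := funext h3
      exact ⟨h1, h2⟩
    · rintro ⟨h1, h2⟩
      exact ⟨_, ⟨fun u => (g u).1, h1, rfl, h2⟩, fun _ => rfl⟩
  have hkey : ∀ (t : DataTree A) (g : t.dom.Node → L × Fin (N + 1)),
      (∀ a ∈ S.keys, ∀ x y : t.dom.Node, g x = a → g y = a → x ≠ y → t.val x ≠ t.val y) ↔
        IsKeyed t g := fun t g =>
    ⟨fun h u v huv hg hl => h (g u) hl u v rfl hg.symm huv,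
      by rintro h a ha x y rfl hy hxy; exact h x y hxy hy.symm ha⟩
  have hword : ∀ (t : DataTree A) (g : t.dom.Node → L × Fin (N + 1)), IsKeyed t g →
      ((t.relabel g).stringRep ∈ S.automaton.accepts ↔
        (∀ d, IsSaturated ((t.relabel g).labelsAt d)) ∧
          ψ.Models t (fun p => {u | pr p (g u).1})) := by
    intro t g hg
    change _ ∈ M.toNFA.accepts ↔ _
    rw [DFA.toNFA_correct, hM, hψ.models_iff_ofTree pr t (fun u => (g u).1)]
    have hsat : (∀ S ∈ (t.relabel g).stringRep, IsSaturated S) ↔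
        ∀ d, IsSaturated ((t.relabel g).labelsAt d) := by
      refine ⟨fun h d l hl => ?_, fun h S hS => ?_⟩
      · refine h _ (List.mem_map_of_mem ?_) l hl
        obtain ⟨u, -, rfl⟩ := hl
        exact (Finset.mem_sort _).2 (Finset.mem_image_of_mem _ (Finset.mem_univ u))
      · obtain ⟨d, -, rfl⟩ := List.mem_map.1 hS
        exact h d
    refine (and_congr_left' hsat).trans (and_congr_right fun hs => ?_)
    have heq := hintikkaType_ofTree t (fun u => (g u).1) k g (fun _ => rfl) hg hs
    constructor
    · rintro ⟨M', h1, h2⟩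
      exact (hN _ _ _ _ (h1.trans heq.symm)).1 h2
    · exact fun h => ⟨_, heq, h⟩
  refine ⟨S, Set.ext fun t => ⟨?_, ?_⟩⟩
  · rintro ⟨g, h1, h2, h3⟩
    obtain ⟨h1, hm⟩ := (hout t g).1 h1
    have h2 := ((hword t g ((hkey t g).1 h3)).1 h2).2
    refine ⟨fun i => {u | (g u).1.2 i}, ?_, ?_⟩
    · rw [hinterp t (fun u => (g u).1) h1]
      exact hm
    · rw [hinterp t (fun u => (g u).1) h1]
      exact h2
  · rintro ⟨X, h1, h2⟩
    let x : t.dom.Node → L := fun u => (e (t.lab u), fun i => u ∈ X i)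
    have hX : unaryInterp t X = fun p => {u | pr p (x u)} := hinterp t x fun _ => rfl
    obtain ⟨g, hg, hk, hs⟩ := exists_numbering t x N
    have hgx : (fun u => (g u).1) = x := funext hg
    rw [hX] at h1 h2
    refine ⟨g, (hout t g).2 ⟨fun u => by rw [hg], ?_⟩, (hword t g hk).2 ⟨hs, ?_⟩,
      (hkey t g).2 hk⟩
    · simp only [hg]
      exact h1
    · simp only [hg]
      exact h2

/-! ## Definable properties of assignments -/

section Definable
variable {A : Type u} {m : ℕ} {V : Type} [DecidableEq V] {O : Set BinRel}

/-- A property of assignments in trees with set variables. -/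
abbrev AssignProp (A : Type u) (m : ℕ) (V : Type) : Type u :=
  ∀ t : DataTree A, (Fin m → Set t.dom.Node) → (V → t.dom.Node) → Prop

/-- The property is expressed by a formula with free variables in `F`. -/
def Definable (O : Set BinRel) (F : Set V) (Φ : AssignProp A m V) : Prop :=
  ∃ θ : FO V (A ⊕ Fin m) O, θ.freeVars ⊆ F ∧
    ∀ t X s, θ.Sat t (unaryInterp t X) s ↔ Φ t X s

namespace Definable
variable {F : Set V} {Φ Ψ : AssignProp A m V}

theorem eq {x y : V} (hx : x ∈ F) (hy : y ∈ F) :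
    Definable (A := A) (m := m) O F fun _ _ s => s x = s y :=
  ⟨.eq x y, by rintro z (rfl | rfl) <;> assumption, fun _ _ _ => Iff.rfl⟩

theorem rel {x y : V} {R : BinRel} (hR : R ∈ O) (hx : x ∈ F) (hy : y ∈ F) :
    Definable (A := A) (m := m) O F fun t _ s => R.Holds t (s x) (s y) :=
  ⟨.rel R hR x y, by rintro z (rfl | rfl) <;> assumption, fun _ _ _ => Iff.rfl⟩

theorem lab {x : V} (hx : x ∈ F) (a : A) :
    Definable (m := m) O F fun t _ s => t.lab (s x) = a :=
  ⟨.pred (.inl a) x, by rintro z rfl; assumption, fun _ _ _ => Iff.rfl⟩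

theorem mem {x : V} (hx : x ∈ F) (i : Fin m) :
    Definable (A := A) O F fun _ X s => s x ∈ X i :=
  ⟨.pred (.inr i) x, by rintro z rfl; assumption, fun _ _ _ => Iff.rfl⟩

theorem not (h : Definable O F Φ) : Definable O F fun t X s => ¬ Φ t X s := by
  obtain ⟨θ, hF, hθ⟩ := h
  exact ⟨.neg θ, hF, fun t X s => not_congr (hθ t X s)⟩

theorem and (h : Definable O F Φ) (h' : Definable O F Ψ) :
    Definable O F fun t X s => Φ t X s ∧ Ψ t X s := by
  obtain ⟨θ, hF, hθ⟩ := h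
  obtain ⟨θ', hF', hθ'⟩ := h'
  exact ⟨.conj θ θ', Set.union_subset hF hF', fun t X s => and_congr (hθ t X s) (hθ' t X s)⟩

theorem or (h : Definable O F Φ) (h' : Definable O F Ψ) :
    Definable O F fun t X s => Φ t X s ∨ Ψ t X s := by
  obtain ⟨θ, hF, hθ⟩ := h
  obtain ⟨θ', hF', hθ'⟩ := h'
  exact ⟨.disj θ θ', Set.union_subset hF hF', fun t X s => or_congr (hθ t X s) (hθ' t X s)⟩

theorem congr (h : Definable O F Φ) (e : ∀ t X s, Φ t X s ↔ Ψ t X s) : Definable O F Ψ := by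
  obtain ⟨θ, hF, hθ⟩ := h
  exact ⟨θ, hF, fun t X s => (hθ t X s).trans (e t X s)⟩

theorem imp (h : Definable O F Φ) (h' : Definable O F Ψ) :
    Definable O F fun t X s => Φ t X s → Ψ t X s :=
  (h.not.or h').congr fun _ _ _ => imp_iff_not_or.symm

theorem all {x : V} (h : Definable O (insert x F) Φ) :
    Definable O F fun t X s => ∀ n, Φ t X (Function.update s x n) := by
  obtain ⟨θ, hF, hθ⟩ := h
  refine ⟨.all x θ, fun y hy => (hF hy.1).resolve_left hy.2, fun t X s => ?_⟩
  exact forall_congr' fun n => hθ t X _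

theorem ex {x : V} (h : Definable O (insert x F) Φ) :
    Definable O F fun t X s => ∃ n, Φ t X (Function.update s x n) := by
  obtain ⟨θ, hF, hθ⟩ := h
  refine ⟨.ex x θ, fun y hy => (hF hy.1).resolve_left hy.2, fun t X s => ?_⟩
  exact exists_congr fun n => hθ t X _

theorem const [Inhabited V] (p : Prop) : Definable (A := A) (m := m) O F fun _ _ _ => p := by
  have h : Definable (A := A) (m := m) O F fun _ _ _ => True :=
    (all (x := default) (eq (Set.mem_insert _ _) (Set.mem_insert _ _))).congr fun _ _ _ => by simp
  by_cases hp : p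
  · exact h.congr fun _ _ _ => by simp [hp]
  · exact h.not.congr fun _ _ _ => by simp [hp]

theorem finite_forall [Inhabited V] {ι : Type w} [Finite ι] {Φ : ι → AssignProp A m V}
    (h : ∀ i, Definable O F (Φ i)) : Definable O F fun t X s => ∀ i, Φ i t X s := by
  have key : ∀ l : List ι, Definable O F fun t X s => ∀ i ∈ l, Φ i t X s := by
    intro l
    induction l with
    | nil => exact (const True).congr fun _ _ _ => by simp
    | cons i l ih => exact ((h i).and ih).congr fun _ _ _ => by simp
  have := Fintype.ofFinite ι
  exact (key Finset.univ.toList).congr fun _ _ _ => by simp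

theorem finite_exists [Inhabited V] {ι : Type w} [Finite ι] {Φ : ι → AssignProp A m V}
    (h : ∀ i, Definable O F (Φ i)) : Definable O F fun t X s => ∃ i, Φ i t X s :=
  (finite_forall fun i => (h i).not).not.congr fun _ _ _ => by simp

end Definable

/-- The label of a node with the set variables that contain it. -/
def nodeType (t : DataTree A) (X : Fin m → Set t.dom.Node) (u : t.dom.Node) :
    A × (Fin m → Prop) := (t.lab u, fun i => u ∈ X i)

theorem Definable.nodeType_eq [Inhabited V] {F : Set V} {x : V} (hx : x ∈ F)
    (κ : A × (Fin m → Prop)) :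
    Definable O F fun t X s => nodeType t X (s x) = κ := by
  have h : ∀ i, Definable (A := A) O F fun _ X s => s x ∈ X i ↔ κ.2 i := fun i =>
    (((mem hx i).imp (const _)).and ((const _).imp (mem hx i))).congr fun _ _ _ =>
      (iff_iff_implies_and_implies).symm
  exact ((lab hx κ.1).and (finite_forall h)).congr fun t X s => by
    simp [nodeType, Prod.ext_iff, funext_iff]

theorem Definable.nodeType [Finite A] [Inhabited V] {F : Set V} {x : V} (hx : x ∈ F)
    (P : A × (Fin m → Prop) → Prop) :
    Definable O F fun t X s => P (nodeType t X (s x)) :=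
  (finite_exists fun κ => (const (P κ)).and (nodeType_eq hx κ)).congr fun t X s => by simp

theorem Definable.nodeType₂ [Finite A] [Inhabited V] {F : Set V} {x y : V} (hx : x ∈ F)
    (hy : y ∈ F) (R : A × (Fin m → Prop) → A × (Fin m → Prop) → Prop) :
    Definable O F fun t X s => R (ODT.nodeType t X (s x)) (ODT.nodeType t X (s y)) :=
  (finite_exists fun κ => (nodeType_eq hx κ).and (nodeType hy (R κ))).congr fun t X s => by simp

theorem Definable.exists_sentence {Φ : ∀ t : DataTree A, (Fin m → Set t.dom.Node) → Prop}
    (h : Definable O (∅ : Set V) fun t X _ => Φ t X) :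
    ∃ θ : FO V (A ⊕ Fin m) O, θ.IsSentence ∧ ∀ t X, θ.Models t (unaryInterp t X) ↔ Φ t X := by
  obtain ⟨θ, hF, hθ⟩ := h
  refine ⟨θ, Set.subset_empty_iff.1 hF, fun t X => ⟨fun hm => ?_, fun hm s => (hθ t X s).2 hm⟩⟩
  exact (hθ t X fun _ => t.dom.root).1 (hm _)

end Definable

/-! ## Labellings with local constraints -/

/-- Constraints on labellings of trees. -/
structure TilingSystem (K : Type u) where
  node : K → Prop
  root : K → Prop
  leaf : K → Prop
  first : K → Prop
  next : K → K → Prop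
  last : K → K → Prop

/-- `κ` satisfies the constraints: `node` at every node, `root` at the root, `leaf` at the leaves,
`first` at the nodes without previous sibling, `next` for a node and its next sibling, and `last`
for a node and its last child. -/
def TilingSystem.Holds {K : Type u} (T : TilingSystem K) (D : TreeDomain) (κ : D.Node → K) :
    Prop :=
  (∀ u, T.node (κ u)) ∧ (∀ u, ¬ (∃ v, D.IsChild v u) → T.root (κ u)) ∧
  (∀ u, ¬ (∃ v, D.IsChild u v) → T.leaf (κ u)) ∧
  (∀ u, ¬ (∃ v, D.IsNextSibling v u) → T.first (κ u)) ∧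
  (∀ u v, D.IsNextSibling u v → T.next (κ u) (κ v)) ∧
  ∀ u v, D.IsChild u v → ¬ (∃ w, D.IsNextSibling v w) → T.last (κ u) (κ v)

/-- The constraints on the images of the labels. -/
def TilingSystem.comap {K : Type u} {K' : Type v} (f : K → K') (T : TilingSystem K') :
    TilingSystem K :=
  ⟨fun κ => T.node (f κ), fun κ => T.root (f κ), fun κ => T.leaf (f κ), fun κ => T.first (f κ),
    fun κ κ' => T.next (f κ) (f κ'), fun κ κ' => T.last (f κ) (f κ')⟩

/-- Two variables suffice because each inner quantifier can reuse a variable: for `last`, the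
absence of a next sibling of `v` is stated by requantifying the variable of the parent. -/
theorem TilingSystem.definable {A : Type u} [Finite A] {m : ℕ}
    (T : TilingSystem (A × (Fin m → Prop))) :
    Definable {BinRel.child, BinRel.nextSibling} (∅ : Set (Fin 2)) fun t X _ =>
      T.Holds t.dom (nodeType t X) := by
  have c : BinRel.child ∈ ({BinRel.child, BinRel.nextSibling} : Set BinRel) := Or.inl rfl
  have n : BinRel.nextSibling ∈ ({BinRel.child, BinRel.nextSibling} : Set BinRel) := Or.inr rfl
  have h0 : ∀ {F : Set (Fin 2)}, (0 : Fin 2) ∈ insert 0 F := Set.mem_insert _ _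
  have h1 : ∀ {F : Set (Fin 2)}, (1 : Fin 2) ∈ insert 1 F := Set.mem_insert _ _
  have h01 : ∀ {F : Set (Fin 2)}, (0 : Fin 2) ∈ insert 1 (insert 0 F) := by simp
  have h10 : ∀ {F : Set (Fin 2)}, (1 : Fin 2) ∈ insert 0 (insert 1 F) := by simp
  have h101 : ∀ {F : Set (Fin 2)}, (1 : Fin 2) ∈ insert 0 (insert 1 (insert 0 F)) := by simp
  have d1 := Definable.all (O := {BinRel.child, BinRel.nextSibling}) (F := ∅)
    (Definable.nodeType h0 T.node)
  have d2 := Definable.all (F := ∅) ((Definable.ex (.rel c h1 h01)).not.imp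
    (Definable.nodeType h0 T.root))
  have d3 := Definable.all (F := ∅) ((Definable.ex (.rel c h01 h1)).not.imp
    (Definable.nodeType h0 T.leaf))
  have d4 := Definable.all (F := ∅) ((Definable.ex (.rel n h1 h01)).not.imp
    (Definable.nodeType h0 T.first))
  have d5 := Definable.all (F := ∅) (Definable.all ((Definable.rel n h01 h1).imp
    (Definable.nodeType₂ h01 h1 T.next)))
  have d6 := Definable.all (F := ∅) (Definable.all ((Definable.rel c h01 h1).imp
    ((Definable.ex (.rel n h101 h0)).not.imp (Definable.nodeType₂ h01 h1 T.last))))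
  refine (d1.and (d2.and (d3.and (d4.and (d5.and d6))))).congr fun t X s => ?_
  simp [TilingSystem.Holds, BinRel.Holds]

/-- Constraints on labellings of sets with data values. -/
structure ValueSystem (K : Type u) (G : Type v) where
  eq : K → K → Prop
  wit : G → K → K → Prop
  first : K → Prop
  suc : K → K → Prop
  last : K → Prop

/-- `κ` satisfies the constraints: `eq` for different nodes with the same data value, `wit i` for
every node and some node with the same data value, `first` for the least data value, `suc` for
consecutive data values, and `last` for the greatest data value. -/
def ValueSystem.Holds {K : Type u} {G : Type v} (T : ValueSystem K G) {A : Type w} (t : DataTree A)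
    (κ : t.dom.Node → K) : Prop :=
  (∀ u v, u ≠ v → t.val u = t.val v → T.eq (κ u) (κ v)) ∧
  (∀ i u, ∃ v, t.val u = t.val v ∧ T.wit i (κ u) (κ v)) ∧
  (∀ u, ¬ (∃ v, t.val v < t.val u) → T.first (κ u)) ∧
  (∀ u v, BinRel.dataSuc.Holds t u v → T.suc (κ u) (κ v)) ∧
  ∀ u, ¬ (∃ v, t.val u < t.val v) → T.last (κ u)

/-- The constraints on the images of the labels. -/
def ValueSystem.comap {K : Type u} {K' : Type v} {G : Type w} (f : K → K')
    (T : ValueSystem K' G) : ValueSystem K G :=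
  ⟨fun κ κ' => T.eq (f κ) (f κ'), fun i κ κ' => T.wit i (f κ) (f κ'), fun κ => T.first (f κ),
    fun κ κ' => T.suc (f κ) (f κ'), fun κ => T.last (f κ)⟩

theorem ValueSystem.definable {A : Type u} [Finite A] {m : ℕ} {G : Type v} [Finite G]
    (T : ValueSystem (A × (Fin m → Prop)) G) :
    Definable {BinRel.dataEq, BinRel.dataLt, BinRel.dataSuc} (∅ : Set ℕ) fun t X _ =>
      T.Holds t (nodeType t X) := by
  have e : BinRel.dataEq ∈ ({BinRel.dataEq, BinRel.dataLt, BinRel.dataSuc} : Set BinRel) := by simp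
  have l : BinRel.dataLt ∈ ({BinRel.dataEq, BinRel.dataLt, BinRel.dataSuc} : Set BinRel) := by simp
  have s : BinRel.dataSuc ∈ ({BinRel.dataEq, BinRel.dataLt, BinRel.dataSuc} : Set BinRel) := by
    simp
  have h0 : ∀ {F : Set ℕ}, 0 ∈ insert 0 F := Set.mem_insert _ _
  have h1 : ∀ {F : Set ℕ}, 1 ∈ insert 1 F := Set.mem_insert _ _
  have h01 : ∀ {F : Set ℕ}, 0 ∈ insert 1 (insert 0 F) := by simp
  have d1 := Definable.all (F := ∅) (Definable.all ((Definable.eq h01 h1).not.imp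
    ((Definable.rel e h01 h1).imp (Definable.nodeType₂ h01 h1 T.eq))))
  have d2 := Definable.finite_forall fun i => Definable.all (F := ∅) (Definable.ex
    ((Definable.rel e h01 h1).and (Definable.nodeType₂ h01 h1 (T.wit i))))
  have d3 := Definable.all (F := ∅) ((Definable.ex (.rel l h1 h01)).not.imp
    (Definable.nodeType h0 T.first))
  have d4 := Definable.all (F := ∅) (Definable.all ((Definable.rel s h01 h1).imp
    (Definable.nodeType₂ h01 h1 T.suc)))
  have d5 := Definable.all (F := ∅) ((Definable.ex (.rel l h01 h1)).not.imp
    (Definable.nodeType h0 T.last))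
  refine (d1.and (d2.and (d3.and (d4.and d5)))).congr fun t X s => ?_
  simp [ValueSystem.Holds, BinRel.Holds]

/-- Existential set variables guess the labelling `c`, and the systems of constraints are then
first-order conditions. -/
theorem exists_formula_of_systems {A : Type u} [Finite A] {C : Type v} [Finite C] {G : Type w}
    [Finite G] (T : TilingSystem (A × C)) (W : ValueSystem (A × C) G) :
    ∃ (m : ℕ) (φ : FO2 A m {BinRel.child, BinRel.nextSibling})
      (ψ : FOω A m {BinRel.dataEq, BinRel.dataLt, BinRel.dataSuc}),
      φ.IsSentence ∧ ψ.IsSentence ∧ definedLanguage φ ψ =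
        {t | ∃ c : t.dom.Node → C, T.Holds t.dom (fun u => (t.lab u, c u)) ∧
          W.Holds t fun u => (t.lab u, c u)} := by
  obtain ⟨m, ⟨e⟩⟩ := Finite.exists_equiv_fin C
  -- For empty `C` no labelling exists, since every tree has a root; a false sentence defines the
  -- empty language.
  rcases isEmpty_or_nonempty C with hC | hC
  · obtain ⟨φ, h1, h2⟩ := Definable.exists_sentence (A := A) (m := m) (V := Fin 2)
      (O := {BinRel.child, BinRel.nextSibling}) (.const False)
    obtain ⟨ψ, h3, h4⟩ := Definable.exists_sentence (A := A) (m := m) (V := ℕ)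
      (O := {BinRel.dataEq, BinRel.dataLt, BinRel.dataSuc}) (.const False)
    refine ⟨m, φ, ψ, h1, h3, Set.ext fun t => ⟨fun ⟨X, h, _⟩ => ((h2 t X).1 h).elim, ?_⟩⟩
    rintro ⟨c, -⟩
    exact hC.elim (c t.dom.root)
  -- One set variable for each element of `C`. Sets that encode nothing are decoded arbitrarily,
  -- which is harmless because any labelling may serve as a witness.
  · let code : C → Fin m → Prop := fun c i => e c = i
    have hcode : Function.Injective code := fun c c' h =>
      e.injective (((congrFun h (e c)).mp rfl : e c' = e c)).symm
    let dec := Function.invFun code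
    have hdec : ∀ c, dec (code c) = c := Function.leftInverse_invFun hcode
    let f : A × (Fin m → Prop) → A × C := fun κ => (κ.1, dec κ.2)
    obtain ⟨φ, h1, h2⟩ := Definable.exists_sentence (T.comap f).definable
    obtain ⟨ψ, h3, h4⟩ := Definable.exists_sentence (W.comap f).definable
    refine ⟨m, φ, ψ, h1, h3, Set.ext fun t => ⟨?_, ?_⟩⟩
    · rintro ⟨X, hφ, hψ⟩
      exact ⟨fun u => dec fun i => u ∈ X i, (h2 t X).1 hφ, (h4 t X).1 hψ⟩
    · rintro ⟨c, hT, hW⟩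
      have hf : ∀ u, f (nodeType t (fun i => {u | code (c u) i}) u) = (t.lab u, c u) :=
        fun u => Prod.ext rfl (hdec (c u))
      refine ⟨fun i => {u | code (c u) i}, (h2 t _).2 ?_, (h4 t _).2 ?_⟩
      · simpa only [TilingSystem.Holds, TilingSystem.comap, hf] using hT
      · simpa only [ValueSystem.Holds, ValueSystem.comap, hf] using hW

/-! ## Automata as systems of local constraints -/

/-- `pre u` is the row of values at the siblings of `u` up to `u` itself, the prefix that a string
automaton has read on reaching `u`. -/
theorem TreeDomain.exists_take_children_map {Q : Type u} (D : TreeDomain) (r : D.Node → Q) :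
    ∃ pre : D.Node → List Q,
      (∀ u, (∀ v, ¬ D.IsNextSibling v u) → pre u = [r u]) ∧
      (∀ u v, D.IsNextSibling u v → pre v = pre u ++ [r v]) ∧
      ∀ u v, D.IsChild u v → (∀ w, ¬ D.IsNextSibling v w) → pre v = (D.children u).map r := by
  classical
  -- The values off the tree are junk; they spare membership proofs in the row below.
  let x : List ℕ → Q := fun w => if h : w ∈ D.nodes then r ⟨w, h⟩ else r D.root
  have hx : ∀ u : D.Node, x u.1 = r u := fun u => dif_pos u.2
  have hchild : ∀ (u : D.Node) (p : List ℕ) (i : ℕ), u.1 = p ++ [i + 1] →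
      ∃ v : D.Node, D.IsNextSibling v u := fun u p i hu =>
    ⟨⟨p ++ [i], D.sibling_closed p (i + 1) i (hu ▸ u.2) (Nat.lt_succ_self i)⟩, p, i, rfl, hu⟩
  refine ⟨fun u => if u.1 = [] then [r u] else
    (List.range (u.1.getLast?.getD 0 + 1)).map fun j => x (u.1.dropLast ++ [j]), ?_, ?_, ?_⟩
  · intro u hu
    dsimp only
    rcases List.eq_nil_or_concat' u.1 with e | ⟨p, i, e⟩
    · rw [if_pos e]
    · cases i with
      | zero =>
        rw [e, if_neg (by simp)]
        simp [← hx u, e]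
      | succ i =>
        obtain ⟨v, hv⟩ := hchild u p i e
        exact absurd hv (hu v)
  · rintro u v ⟨p, i, e, e'⟩
    dsimp only
    rw [e, e', if_neg (by simp), if_neg (by simp)]
    simp [List.range_succ, ← hx v, e']
  · rintro u v ⟨i, e⟩ hv
    dsimp only
    have hn : D.numChildren u = i + 1 := by
      have h1 : i < D.numChildren u := (D.lt_numChildren_iff u i).2 (e ▸ v.2)
      have h2 : ¬ i + 1 < D.numChildren u := fun h =>
        hv ⟨u.1 ++ [i + 1], (D.lt_numChildren_iff u _).1 h⟩ ⟨u.1, i, e, rfl⟩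
      omega
    rw [e, if_neg (by simp)]
    refine List.ext_getElem (by simp [children, hn]) fun j h1 h2 => ?_
    simp [children, child, ← hx]

theorem dfa_eval_children {Q : Type u} {σ : Type v} (M : DFA Q σ) (D : TreeDomain)
    (r : D.Node → Q) (e : D.Node → σ)
    (hfirst : ∀ u, ¬ (∃ v, D.IsNextSibling v u) → e u = M.step M.start (r u))
    (hnext : ∀ u v, D.IsNextSibling u v → e v = M.step (e u) (r v)) {u v : D.Node}
    (huv : D.IsChild u v) (hlast : ¬ ∃ w, D.IsNextSibling v w) :
    M.eval ((D.children u).map r) = e v := by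
  obtain ⟨pre, h1, h2, h3⟩ := D.exists_take_children_map r
  push Not at hlast
  rw [← h3 u v huv hlast]
  have key : ∀ (p : List ℕ) (i : ℕ) (w : D.Node), w.1 = p ++ [i] → M.eval (pre w) = e w := by
    intro p i
    induction i with
    | zero =>
      intro w hw
      have hno : ¬ ∃ v, D.IsNextSibling v w := by
        rintro ⟨v, q, i, -, hq⟩
        have := (append_singleton_inj.1 (hw.symm.trans hq)).2
        omega
      rw [h1 w (not_exists.1 hno), hfirst w hno, DFA.eval_singleton]
    | succ i ih =>
      intro w hw
      have hm : p ++ [i] ∈ D.nodes :=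
        D.sibling_closed p (i + 1) i (hw ▸ w.2) (Nat.lt_succ_self i)
      have hs : D.IsNextSibling ⟨p ++ [i], hm⟩ w := ⟨p, i, rfl, hw⟩
      rw [h2 _ w hs, DFA.eval_append_singleton, ih _ rfl, hnext _ _ hs]
  obtain ⟨i, hi⟩ := huv
  exact key _ i v hi

/-- The constraints for the runs of a tree transducer. -/
def TreeTransducer.tiling {A : Type u} {B : Type} (T : TreeTransducer A B)
    {σ : T.automaton.State × A → Type} (M : ∀ p, DFA T.automaton.State (σ p)) :
    TilingSystem (A × T.automaton.State × (∀ p, σ p) × B) where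
  node := fun (a, q, _, b) => (q, a, b) ∈ T.output
  root := fun (_, q, _, _) => q ∈ T.automaton.final
  leaf := fun (a, q, _, _) => (M (q, a)).start ∈ (M (q, a)).accept
  first := fun (_, q, e, _) => ∀ p, e p = (M p).step (M p).start q
  next := fun (_, _, e, _) (_, q', e', _) => ∀ p, e' p = (M p).step (e p) q'
  last := fun (a, q, _, _) (_, _, e', _) => e' (q, a) ∈ (M (q, a)).accept

/-- The transition language at a node depends on its state and label, which the constraints between
siblings do not see. So every node carries the states of all the automata `M p` at once, and the
parent selects the relevant one at its last child. -/
theorem TreeTransducer.isOutput_iff_tiling {A : Type u} {B : Type} (T : TreeTransducer A B)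
    {σ : T.automaton.State × A → Type} (M : ∀ p, DFA T.automaton.State (σ p))
    (hM : ∀ p, (M p).accepts = T.automaton.trans p.1 p.2) (D : TreeDomain) (x : D.Node → A)
    (g : D.Node → B) : T.IsOutput ⟨D, x⟩ g ↔
      ∃ (r : D.Node → T.automaton.State) (e : D.Node → ∀ p, σ p),
        (T.tiling M).Holds D fun u => (x u, r u, e u, g u) := by
  have hroot : ∀ u : D.Node, ¬ (∃ v, D.IsChild v u) ↔ u = D.root := by
    intro u
    constructor
    · intro h
      rcases List.eq_nil_or_concat' u.1 with e | ⟨p, i, e⟩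
      · exact Subtype.ext e
      · exact absurd ⟨⟨p, D.prefix_closed _ _ u.2 ⟨[i], e.symm⟩⟩, i, e⟩ h
    · rintro rfl ⟨v, i, h⟩
      simp [TreeDomain.root] at h
  have hleaf : ∀ u : D.Node, ¬ (∃ v, D.IsChild u v) ↔ D.children u = [] := by
    intro u
    simp only [D.isChild_iff, List.eq_nil_iff_forall_not_mem, not_exists]
  have hlast : ∀ u : D.Node, D.children u ≠ [] →
      ∃ v, D.IsChild u v ∧ ¬ ∃ w, D.IsNextSibling v w := by
    intro u hu
    obtain ⟨a, v, e⟩ := (List.eq_nil_or_concat' (D.children u)).resolve_left hu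
    have e' : D.children u = a ++ v :: [] := e
    refine ⟨v, (D.isChild_iff _ _).2 (by simp [e]), ?_⟩
    rintro ⟨w, p, i, h1, h2⟩
    obtain ⟨rfl, rfl⟩ := append_singleton_inj.1 (h1.symm.trans (TreeDomain.children_split_mid e'))
    have := (TreeDomain.children_split_right_getElem? e' w 0).2 h2
    simp at this
  constructor
  · rintro ⟨r, ⟨hr, hf⟩, ho⟩
    obtain ⟨pre, h1, h2, h3⟩ := D.exists_take_children_map r
    refine ⟨r, fun u p => (M p).eval (pre u), ho, fun u hu => ?_, fun u hu => ?_, fun u hu p => ?_,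
      fun u v huv p => ?_, fun u v huv hv => ?_⟩
    · rw [(hroot u).1 hu]
      exact hf
    · have : (D.children u).map r ∈ T.automaton.trans (r u) (x u) := hr u
      rw [(hleaf u).1 hu, ← hM (r u, x u)] at this
      exact this
    · dsimp only
      rw [h1 u (not_exists.1 hu), DFA.eval_singleton]
    · dsimp only
      rw [h2 u v huv, DFA.eval_append_singleton]
    · have : (D.children u).map r ∈ T.automaton.trans (r u) (x u) := hr u
      rw [← h3 u v huv (not_exists.1 hv), ← hM (r u, x u)] at this
      exact this
  · rintro ⟨r, e, h1, h2, h3, h4, h5, h6⟩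
    refine ⟨r, ⟨fun u => ?_, h2 _ ((hroot _).2 rfl)⟩, h1⟩
    change (D.children u).map r ∈ T.automaton.trans (r u) (x u)
    rw [← hM (r u, x u), DFA.mem_accepts]
    by_cases hu : D.children u = []
    · rw [hu]
      exact h3 u ((hleaf u).2 hu)
    · obtain ⟨v, huv, hv⟩ := hlast u hu
      rw [dfa_eval_children (M (r u, x u)) D r (fun w => e w (r u, x u)) (fun w hw => h4 w hw _)
        (fun w w' hw => h5 w w' hw _) huv hv]
      exact h6 u v huv hv

/-- The constraints for the runs of a string automaton on the string representation, and for the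
keys. -/
def valueSystem {B σ : Type} (M : DFA (Set B) σ) (keys : Set B) :
    ValueSystem (B × Set B × σ) B where
  eq := fun (b, S, n) (b', S', n') => S = S' ∧ n = n' ∧ (b = b' → b ∉ keys)
  wit := fun c (b, S, _) (b', _, _) => b ∈ S ∧ (c ∈ S → b' = c)
  first := fun (_, S, n) => n = M.step M.start S
  suc := fun (_, _, n) (_, S', n') => n' = M.step n S'
  last := fun (_, _, n) => n ∈ M.accept

/-- The nodes of one data value share a letter `S u` and a state `n u`, the state after reading the
letters up to that value. The witness condition forces `S u` to be the exact set of labels, and the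
order conditions force the states. -/
theorem valueSystem_holds_iff {A : Type u} {B σ : Type} (M : DFA (Set B) σ) (keys : Set B)
    (t : DataTree A) (g : t.dom.Node → B) :
    ((t.relabel g).stringRep ∈ M.accepts ∧
      ∀ a ∈ keys, ∀ x y : t.dom.Node, g x = a → g y = a → x ≠ y → t.val x ≠ t.val y) ↔
    ∃ (S : t.dom.Node → Set B) (n : t.dom.Node → σ),
      (valueSystem M keys).Holds t fun u => (g u, S u, n u) := by
  set V := t.values.sort (· ≤ ·) with hV
  have hmono : V.SortedLT := Finset.sortedLT_sort _
  have hmem : ∀ u, t.val u ∈ V := fun u => by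
    rw [hV, Finset.mem_sort]
    exact Finset.mem_image_of_mem _ (Finset.mem_univ u)
  have hnode : ∀ i < V.length, ∃ u, V[i]? = some (t.val u) := by
    intro i hi
    have : V[i] ∈ t.values := by
      rw [← Finset.mem_sort (r := (· ≤ ·))]
      exact List.getElem_mem hi
    obtain ⟨u, -, hu⟩ := Finset.mem_image.1 this
    exact ⟨u, by rw [List.getElem?_eq_getElem hi, hu]⟩
  have hlt : ∀ {i j : ℕ} {u v : t.dom.Node}, V[i]? = some (t.val u) → V[j]? = some (t.val v) →
      (t.val u < t.val v ↔ i < j) := by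
    intro i j u v hi hj
    obtain ⟨h1, e1⟩ := List.getElem?_eq_some_iff.1 hi
    obtain ⟨h2, e2⟩ := List.getElem?_eq_some_iff.1 hj
    rw [← e1, ← e2]
    exact hmono.strictMono_get.lt_iff_lt (a := ⟨_, h1⟩) (b := ⟨_, h2⟩)
  have hidx : ∀ u, V[V.idxOf (t.val u)]? = some (t.val u) := fun u =>
    List.getElem?_idxOf (hmem u)
  have hle : ∀ {i : ℕ} {u : t.dom.Node}, V[i]? = some (t.val u) → i < V.length := fun h =>
    (List.getElem?_eq_some_iff.1 h).1
  let W := (t.relabel g).labelsAt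
  have hrep : (t.relabel g).stringRep = V.map W := rfl
  -- The state after the letter at position `i`, hence the prefix of length `i + 1`.
  let N : ℕ → σ := fun i => M.eval ((V.take (i + 1)).map W)
  have hzero : ∀ {u}, V[0]? = some (t.val u) → N 0 = M.step M.start (W (t.val u)) := by
    intro u hu
    simp only [N, List.take_add_one, hu, List.take_zero]
    rfl
  have hsucc : ∀ {i u}, V[i + 1]? = some (t.val u) → N (i + 1) = M.step (N i) (W (t.val u)) := by
    intro i u hu
    simp only [N, List.take_add_one (i := i + 1), hu, Option.toList_some, List.map_append,
      List.map_singleton, DFA.eval_append_singleton]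
  have hacc : (t.relabel g).stringRep ∈ M.accepts ↔ N (V.length - 1) ∈ M.accept := by
    rw [DFA.mem_accepts, hrep]
    simp only [N]
    rw [List.take_of_length_le (by omega)]
  constructor
  · rintro ⟨hw, hk⟩
    refine ⟨fun u => W (t.val u), fun u => N (V.idxOf (t.val u)), fun u v huv h => ?_,
      fun b u => ?_, fun u hu => ?_, fun u v huv => ?_, fun u hu => ?_⟩
    · exact ⟨congrArg W h, congrArg (fun d => N (V.idxOf d)) h,
        fun hg hkey => hk _ hkey u v rfl hg.symm huv h⟩
    · by_cases hb : b ∈ W (t.val u)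
      · obtain ⟨v, h1, h2⟩ := hb
        exact ⟨v, h2.symm, ⟨u, rfl, rfl⟩, fun _ => h1⟩
      · exact ⟨u, rfl, ⟨u, rfl, rfl⟩, fun h => absurd h hb⟩
    · have h0 : V.idxOf (t.val u) = 0 := by
        by_contra h0
        have := hle (hidx u)
        obtain ⟨v, hv⟩ := hnode 0 (by omega)
        exact hu ⟨v, (hlt hv (hidx u)).2 (by omega)⟩
      have := hidx u
      rw [h0] at this
      change N (V.idxOf (t.val u)) = _
      rw [h0]
      exact hzero this
    · obtain ⟨h1, h2⟩ := huv
      have hl := (hlt (hidx u) (hidx v)).1 h1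
      have hs : V.idxOf (t.val v) = V.idxOf (t.val u) + 1 := by
        by_contra hs
        have := hle (hidx v)
        obtain ⟨z, hz⟩ := hnode (V.idxOf (t.val u) + 1) (by omega)
        have h3 := h2 z ((hlt (hidx u) hz).2 (by omega))
        have := (hlt hz (hidx v)).2 (by omega)
        omega
      have := hidx v
      rw [hs] at this
      change N (V.idxOf (t.val v)) = _
      rw [hs]
      exact hsucc this
    · have hs : V.idxOf (t.val u) = V.length - 1 := by
        by_contra hs
        have := hle (hidx u)
        obtain ⟨z, hz⟩ := hnode (V.length - 1) (by omega)
        exact hu ⟨z, (hlt (hidx u) hz).2 (by omega)⟩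
      change N (V.idxOf (t.val u)) ∈ _
      rw [hs]
      exact hacc.1 hw
  · rintro ⟨S, n, h1, h2, h3, h4, h5⟩
    -- The witness condition gives a node for each letter of `S u`, and puts the label of each node
    -- into its own set, which `eq` makes common to the data value.
    have hS : ∀ u, S u = W (t.val u) := by
      intro u
      ext b
      constructor
      · intro hb
        obtain ⟨v, hv, -, h⟩ := h2 b u
        exact ⟨v, h hb, hv.symm⟩
      · rintro ⟨v, rfl, hv⟩
        have hv' : g v ∈ S v := (h2 (g v) v).choose_spec.2.1
        by_cases e : u = v
        · exact e ▸ hv'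
        · exact (h1 u v e hv.symm).1 ▸ hv'
    have hn : ∀ i u, V[i]? = some (t.val u) → n u = N i := by
      intro i
      induction i with
      | zero =>
        intro u hu
        rw [hzero hu, ← hS]
        refine h3 u ?_
        rintro ⟨v, hv⟩
        have := (hlt (hidx v) hu).1 hv
        omega
      | succ i ih =>
        intro u hu
        obtain ⟨v, hv⟩ := hnode i (by have := hle hu; omega)
        rw [hsucc hu, ← hS, ← ih v hv]
        refine h4 v u ⟨(hlt hv hu).2 (Nat.lt_succ_self i), fun z hz => ?_⟩
        have e1 := (hlt hv (hidx z)).1 hz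
        by_contra! hzu
        have := (hlt (hidx z) hu).1 hzu
        omega
    refine ⟨?_, ?_⟩
    -- The root shows that there is at least one data value, so a last one exists.
    · have := hle (hidx t.dom.root)
      obtain ⟨u, hu⟩ := hnode (V.length - 1) (by omega)
      rw [hacc, ← hn _ u hu]
      refine h5 u ?_
      rintro ⟨v, hv⟩
      have := (hlt hu (hidx v)).1 hv
      have := hle (hidx v)
      omega
    · rintro a ha u v rfl hv huv hval
      exact (h1 u v huv hval).2.2 hv.symm ha

theorem WeakODTA.exists_formula {A : Type u} [Finite A] (S : WeakODTA A) :
    ∃ (m : ℕ) (φ : FO2 A m {BinRel.child, BinRel.nextSibling})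
      (ψ : FOω A m {BinRel.dataEq, BinRel.dataLt, BinRel.dataSuc}),
      φ.IsSentence ∧ ψ.IsSentence ∧ definedLanguage φ ψ = S.language := by
  have := S.finite_out
  have := S.finite_state
  have := S.transducer.automaton.finite_state
  choose σ hσ M hM using fun p : S.transducer.automaton.State × A =>
    S.transducer.automaton.regular_trans p.1 p.2
  -- The string automaton is made deterministic so that a single state at each data value records
  -- its computation.
  let W := valueSystem S.automaton.toDFA S.keys
  let T := S.transducer.tiling M
  obtain ⟨m, φ, ψ, hφ, hψ, h⟩ := exists_formula_of_systems (A := A)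
    (C := (S.transducer.automaton.State × (∀ p, σ p) × S.Out) × Set S.Out × Set S.State)
    -- Both systems read the same component for the output label, so they speak of one common output
    -- tree.
    (T.comap fun κ => (κ.1, κ.2.1)) (W.comap fun κ => (κ.2.1.2.2, κ.2.2))
  refine ⟨m, φ, ψ, hφ, hψ, h.trans (Set.ext fun t => ⟨?_, ?_⟩)⟩
  · rintro ⟨c, hT, hW⟩
    refine ⟨fun u => (c u).1.2.2, ?_, ?_⟩
    · exact (S.transducer.isOutput_iff_tiling M hM t.dom t.lab _).2
        ⟨fun u => (c u).1.1, fun u => (c u).1.2.1, hT⟩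
    · rw [← NFA.toDFA_correct]
      exact (valueSystem_holds_iff _ _ t _).2 ⟨fun u => (c u).2.1, fun u => (c u).2.2, hW⟩
  · rintro ⟨g, h1, h2⟩
    obtain ⟨r, e, hT⟩ := (S.transducer.isOutput_iff_tiling M hM t.dom t.lab g).1 h1
    rw [← NFA.toDFA_correct] at h2
    obtain ⟨X, n, hW⟩ := (valueSystem_holds_iff _ _ t g).1 h2
    exact ⟨fun u => ((r u, e u, g u), X u, n u), hT, hW⟩

end ODT

theorem mainTheorem5 {A : Type*} [Finite A] (L : Set (ODT.DataTree A)) :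
    (∃ S : ODT.WeakODTA A, S.language = L) ↔
      ∃ (m : ℕ) (φ : ODT.FO2 A m {ODT.BinRel.child, ODT.BinRel.nextSibling})
        (ψ : ODT.FOω A m {ODT.BinRel.dataEq, ODT.BinRel.dataLt, ODT.BinRel.dataSuc}),
        φ.IsSentence ∧ ψ.IsSentence ∧ ODT.definedLanguage φ ψ = L := by
  constructor
  · rintro ⟨S, rfl⟩
    exact S.exists_formula
  · rintro ⟨m, φ, ψ, hφ, hψ, rfl⟩
    exact ODT.exists_weakODTA_of_formula φ ψ hφ hψ
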